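/- **Setting.** Let $\mathbb M$ be a connected $d$-dimensional Riemannian manifold with distance $\mathrm{dist}$, volume measure $\mu$ and open balls $B(x,r)$. Let $\Omega\subset\mathbb M$ be compact. Let $r_\Omega>0$ and $0<\Gamma_1\le\Gamma_2$ be such that for every $z\in\Omega$ the exponential map $\mathrm{Exp}_z$ is a smooth diffeomorphism of the ball of radius $r_\Omega$ about $0$ in $T_z\mathbb M$ onto $B(z,r_\Omega)$ with $\mathrm{dist}(z,\mathrm{Exp}_z(v))=\|v\|$ and $\Gamma_1\|v-w\|\le \mathrm{dist}(\mathrm{Exp}_z(v),\mathrm{Exp}_z(w))\le\Gamma_2\|v-w\|$ for $\|v\|,\|w\|<r_\Omega$. Assume $\Omega$ satisfies an interior cone condition of radius $r^\flat>0$ and aperture $\theta\in(0,\pi/2)$: for each $z\in\Omega$ there is a unit vector $v\in T_z\mathbb M$ such that $\mathrm{Exp}_z(w)$ is defined and lies in $\Omega$ for all $w\in T_z\mathbb M$ with $\|w\|\le r^\flat$ and $\langle v,w\rangle\ge\|w\|\cos\theta$. Let $r^\sharp>0$ and $r^*=\min(r_\Omega,r^\sharp,r^\flat)$. **Lemma.**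 There are constants $0<\alpha_\Omega\le\omega_\Omega$ with $$\alpha_\Omega r^d\le\mu(B(x,r)\cap\Omega)\le\omega_\Omega r^d\qquad(x\in\Omega,\ 0<r\le r^*)\tag{1}$$ such that the following holds for all $\Pi,\Xi,\mathcal W,c_0,c_1,\delta$ as below. * $\Pi\subset C^1(\mathbb M)$ is a finite dimensional space of functions with constants $\mathfrak D,\mathfrak M>0$ such that $$\|p\|_{C(B(x,2r))}\le2^{\mathfrak D}\|p\|_{C(B(x,r))},\qquad \|\nabla p\|_{C(B(x,r))}\le\tfrac{\mathfrak M}{r}\|p\|_{C(B(x,r))}$$ for all $p\in\Pi$, $0<r<r^\sharp$, $x\in\mathbb M$. Put $$\kappa=\mathfrak M\,2^{2\mathfrak D}\Big(\frac{2+\sin\theta}{\Gamma_1\sin\theta}\Big)^{\mathfrak D}\frac{1+\Gamma_1\sin\theta}{\Gamma_1\sin\theta},$$ and assume that $\mathfrak M$ is large enough that $\kappa\ge\frac{1+\Gamma_1\sin\theta}{\Gamma_1\sin\theta}$ (for instance $\mathfrak M\ge1$). * $\Xi\subset\Omega$ is a finite nonempty set with fill distance $h=\max_{x\in\Omega}\mathrm{dist}(x,\Xi)\le\frac{r^*}{3\kappa}$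 and separation $q=\min_{\xi\in\Xi}\mathrm{dist}(\xi,\Xi\setminus\{\xi\})$. * $c_0\in(0,1)$, $c_1\in(0,1]$, $\delta\ge\frac{3\kappa}{c_0}h$, and $\mathcal W$ is a weight function with $0\le\mathcal W\le1$ on $\Omega\times\Omega$ and, for $\zeta,z\in\Omega$, $$\mathrm{dist}(\zeta,z)\ge\delta\Rightarrow\mathcal W(\zeta,z)=0,\qquad \mathrm{dist}(\zeta,z)\le c_0\delta\Rightarrow\mathcal W(\zeta,z)\ge c_1.$$ Then for each $z\in\Omega$ there is a unique vector $b^\star(\cdot,z)\in\mathbb R^\Xi$ that vanishes at the $\xi$ with $\mathcal W(\xi,z)=0$ and minimizes $$\sum_{\xi\in\Xi,\ \mathcal W(\xi,z)>0}\frac{|c_\xi|^2}{\mathcal W(\xi,z)}\quad\text{over } c\in\mathbb R^\Xi\text{ subject to}\quad\sum_{\xi\in\Xi,\ \mathcal W(\xi,z)>0}c_\xi\,p(\xi)=p(z)\ \text{ for all }p\in\Pi$$ (the Backus–Gilbert/moving least squares shape functions), and 1. $p(z)=\sum_{\xi\in\Xi}b^\star(\xi,z)p(\xi)$ for all $p\in\Pi$;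 2. $\{\xi\in\Xi: b^\star(\xi,z)\neq0\}\subset B(z,\delta)\cap\Omega$; 3. $\displaystyle\sum_{\xi\in\Xi}|b^\star(\xi,z)|\le2\sqrt{\frac{\omega_\Omega}{c_1\alpha_\Omega}}\Big(\frac\delta q\Big)^{d/2}$. Moreover, if $\alpha,\beta$ are any constants with $\alpha>0$ that satisfy (1) in place of $\alpha_\Omega,\omega_\Omega$, and $\delta+\frac q2\le r^*$, then $\displaystyle\sum_{\xi\in\Xi}|b^\star(\xi,z)|\le2\sqrt{\frac{\beta}{c_1\alpha}}\Big(1+\frac{2\delta}q\Big)^{d/2}$. -/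

import Mathlib

open Set Filter Topology MeasureTheory Bundle Manifold
open scoped ENNReal NNReal ContDiff

noncomputable section

namespace MLS

section Geometry

variable {d : ℕ} {M : Type*} [MetricSpace M] [ChartedSpace (EuclideanSpace ℝ (Fin d)) M]
  [IsManifold (𝓡 d) ∞ M] [RiemannianBundle (fun x : M => TangentSpace (𝓡 d) x)]

/-- The metric tensor in the coordinates given by the preferred chart at `x`: the value at the
coordinate point `y` of the bilinear form `g` on the coordinate vectors `u`, `w`. -/
def chartMetric (x : M) (y u w : EuclideanSpace ℝ (Fin d)) : ℝ :=
  inner ℝ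
    (mfderiv (𝓡 d) (𝓡 d) (extChartAt (𝓡 d) x).symm y u :
      TangentSpace (𝓡 d) ((extChartAt (𝓡 d) x).symm y))
    (mfderiv (𝓡 d) (𝓡 d) (extChartAt (𝓡 d) x).symm y w :
      TangentSpace (𝓡 d) ((extChartAt (𝓡 d) x).symm y))

/-- The Riemannian volume density `√(det (g_{ij}))` in the preferred chart at `x`. -/
def chartDensity (x : M) (y : EuclideanSpace ℝ (Fin d)) : ℝ :=
  Real.sqrt (Matrix.det (Matrix.of fun i j : Fin d =>
    chartMetric x y (EuclideanSpace.single i (1 : ℝ)) (EuclideanSpace.single j (1 : ℝ))))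

/-- The measure `√(det (g_{ij})) dx₁ ⋯ dx_d` on the domain of the preferred chart at `x`,
extended by zero to `M`. -/
def chartVolume [MeasurableSpace M] (x : M) : Measure M :=
  ((volume.restrict (extChartAt (𝓡 d) x).target).withDensity
    (fun y => ENNReal.ofReal (chartDensity x y))).map (extChartAt (𝓡 d) x).symm

variable (d M) in
/-- The Riemannian volume measure. The chart measures agree on overlaps of chart domains, and the
volume measure, which restricts to each of them, is the least measure dominating all of them. -/
def riemannianVolume [MeasurableSpace M] : Measure M :=
  ⨆ x : M, chartVolume (d := d) x

/-- `γ` satisfies the geodesic equation at time `t`. In the chart at `γ t`, with coordinate curve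
`c`, the equation `∑ₗ g_{kl} (c''ˡ + ∑_{ij} Γˡ_{ij} c'ⁱ c'ʲ) = 0`, contracted with an arbitrary
coordinate vector `w`, reads
`g(c'', w) + (D g)[c'](c', w) - ½ (D g)[w](c', c') = 0`. -/
def GeodesicEquationAt (γ : ℝ → M) (t : ℝ) : Prop :=
  let c : ℝ → EuclideanSpace ℝ (Fin d) := fun s => extChartAt (𝓡 d) (γ t) (γ s)
  ∀ w : EuclideanSpace ℝ (Fin d),
    chartMetric (γ t) (c t) (deriv (deriv c) t) w
      + fderiv ℝ (fun y => chartMetric (γ t) y (deriv c t) w) (c t) (deriv c t)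
      - 1 / 2 * fderiv ℝ (fun y => chartMetric (γ t) y (deriv c t) (deriv c t)) (c t) w = 0

/-- `γ` is a geodesic on an open interval containing `[0, 1]`. -/
def IsGeodesic (γ : ℝ → M) : Prop :=
  ∃ ε > (0 : ℝ), ContMDiffOn 𝓘(ℝ, ℝ) (𝓡 d) 2 γ (Ioo (-ε) (1 + ε)) ∧
    ∀ t ∈ Ioo (-ε) (1 + ε), GeodesicEquationAt (d := d) γ t

/-- `y = γ(1)` for a geodesic `γ` with `γ(0) = z` and `γ'(0) = v`. -/
def IsExp (z : M) (v : TangentSpace (𝓡 d) z) (y : M) : Prop :=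
  ∃ γ : ℝ → M, IsGeodesic (d := d) γ ∧
    (⟨γ 0, mfderiv 𝓘(ℝ, ℝ) (𝓡 d) γ 0 (1 : ℝ)⟩ : TangentBundle (𝓡 d) M) = ⟨z, v⟩ ∧ γ 1 = y

/-- The domain of the exponential map at `z` (`M` need not be complete). -/
def expDomain (z : M) : Set (TangentSpace (𝓡 d) z) := {v | ∃ y, IsExp z v y}

open Classical in
/-- The Riemannian exponential map at `z` (with the value `z` outside of its domain). -/
def expMap (z : M) (v : TangentSpace (𝓡 d) z) : M :=
  if h : ∃ y, IsExp z v y then h.choose else z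

/-- `r` is a radius such that, for each `z ∈ Ω`, the exponential map at `z` is a smooth
diffeomorphism of the ball `B(0, r)` of the tangent space onto the geodesic ball `B(z, r)`, it
preserves radial distances, and it distorts distances in `B(0, r)` by factors between `Γ₁` and
`Γ₂`. -/
structure IsNormalRadius (Ω : Set M) (r Γ₁ Γ₂ : ℝ) : Prop where
  radius_pos : 0 < r
  lower_pos : 0 < Γ₁
  lower_le_upper : Γ₁ ≤ Γ₂
  subset_domain : ∀ z ∈ Ω, ∀ v : TangentSpace (𝓡 d) z, ‖v‖ < r → v ∈ expDomain z
  diffeo : ∀ z ∈ Ω, ∃ Φ : PartialDiffeomorph (𝓡 d) (𝓡 d) (EuclideanSpace ℝ (Fin d)) M ∞,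
    Φ.source = {v : TangentSpace (𝓡 d) z | ‖v‖ < r} ∧ Φ.target = Metric.ball z r ∧
      ∀ v : TangentSpace (𝓡 d) z, ‖v‖ < r → Φ v = expMap z v
  radial : ∀ z ∈ Ω, ∀ v : TangentSpace (𝓡 d) z, ‖v‖ < r → dist z (expMap z v) = ‖v‖
  lower : ∀ z ∈ Ω, ∀ v w : TangentSpace (𝓡 d) z, ‖v‖ < r → ‖w‖ < r →
    Γ₁ * ‖v - w‖ ≤ dist (expMap z v) (expMap z w)
  upper : ∀ z ∈ Ω, ∀ v w : TangentSpace (𝓡 d) z, ‖v‖ < r → ‖w‖ < r →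
    dist (expMap z v) (expMap z w) ≤ Γ₂ * ‖v - w‖

variable (d) in
/-- The interior cone condition of radius `r` and aperture `θ`: each `z ∈ Ω` has a unit direction
`v` such that the geodesic cone
`Exp_z {w | ‖w‖ ≤ r, ⟨v, w⟩ ≥ ‖w‖ cos θ}` is contained in `Ω`. -/
def InteriorCone (Ω : Set M) (r θ : ℝ) : Prop :=
  ∀ z ∈ Ω, ∃ v : TangentSpace (𝓡 d) z, ‖v‖ = 1 ∧
    ∀ w : TangentSpace (𝓡 d) z, ‖w‖ ≤ r → ‖w‖ * Real.cos θ ≤ inner ℝ v w →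
      w ∈ expDomain z ∧ expMap z w ∈ Ω

/-- The supremum norm of `p` over a set, as an extended nonnegative real. -/
def supNorm (p : M → ℝ) (s : Set M) : ℝ≥0∞ := ⨆ y ∈ s, ‖p y‖ₑ

variable (d) in
/-- The supremum of `‖∇p‖` over a set, as an extended nonnegative real; the norm of the
differential at `y` is the dual norm of the Riemannian norm on the tangent space. -/
def gradSupNorm (p : M → ℝ) (s : Set M) : ℝ≥0∞ :=
  ⨆ y ∈ s, ‖(mfderiv (𝓡 d) 𝓘(ℝ, ℝ) p y : TangentSpace (𝓡 d) y →L[ℝ] ℝ)‖ₑ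

variable (d) in
/-- `P` is a finite dimensional space of `C¹` functions with a doubling inequality (constant `D`)
and a Markov inequality (constant `K`), valid on all balls of radius less than `r₀`. -/
structure DoublingMarkov (P : Submodule ℝ (M → ℝ)) (D K r₀ : ℝ) : Prop where
  finiteDimensional : FiniteDimensional ℝ P
  contMDiff : ∀ p ∈ P, ContMDiff (𝓡 d) 𝓘(ℝ, ℝ) 1 p
  doubling_pos : 0 < D
  markov_pos : 0 < K
  doubling : ∀ p ∈ P, ∀ r : ℝ, 0 < r → r < r₀ → ∀ x : M,
    supNorm p (Metric.ball x (2 * r)) ≤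
      ENNReal.ofReal ((2 : ℝ) ^ D) * supNorm p (Metric.ball x r)
  markov : ∀ p ∈ P, ∀ r : ℝ, 0 < r → r < r₀ → ∀ x : M,
    gradSupNorm d p (Metric.ball x r) ≤ ENNReal.ofReal (K / r) * supNorm p (Metric.ball x r)

variable (d) in
/-- `α r^d ≤ μ(B(x, r) ∩ Ω) ≤ β r^d` for all `x ∈ Ω` and `0 < r ≤ R`. -/
def BallBound [MeasurableSpace M] (Ω : Set M) (R α β : ℝ) : Prop :=
  ∀ x ∈ Ω, ∀ r : ℝ, 0 < r → r ≤ R →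
    ENNReal.ofReal (α * r ^ d) ≤ riemannianVolume d M (Metric.ball x r ∩ Ω) ∧
    riemannianVolume d M (Metric.ball x r ∩ Ω) ≤ ENNReal.ofReal (β * r ^ d)

end Geometry

/-- The constant
`κ = K 2^(2D) ((2 + sin θ)/(Γ₁ sin θ))^D (1 + Γ₁ sin θ)/(Γ₁ sin θ)`. -/
def kappa (D K Γ₁ θ : ℝ) : ℝ :=
  K * (2 : ℝ) ^ (2 * D) * ((2 + Real.sin θ) / (Γ₁ * Real.sin θ)) ^ D *
    ((1 + Γ₁ * Real.sin θ) / (Γ₁ * Real.sin θ))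

section Points

variable {M : Type*} [MetricSpace M]

/-- The fill distance `h = sup_{x ∈ Ω} dist(x, Ξ)` (for nonempty `Ξ` and bounded `Ω`). -/
def fillDistance (Ξ : Finset M) (Ω : Set M) : ℝ :=
  sSup ((fun x => Metric.infDist x (Ξ : Set M)) '' Ω)

/-- The separation radius `q = min_{ξ ∈ Ξ} dist(ξ, Ξ \ {ξ})` (for `Ξ` with at least two points). -/
def separation (Ξ : Finset M) : ℝ := Set.infsep (Ξ : Set M)

open Classical in
/-- The Backus–Gilbert functional `∑ |c_ξ|² / W(ξ, z)`, the sum being over the `ξ ∈ Ξ` with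
`W(ξ, z) > 0`. -/
def bgCost (Ξ : Finset M) (W : M → M → ℝ) (z : M) (c : Ξ → ℝ) : ℝ :=
  ∑ ξ ∈ Finset.univ.filter (fun ξ : Ξ => 0 < W ξ z), 1 / W ξ z * |c ξ| ^ 2

open Classical in
/-- The constraint `∑ c_ξ p(ξ) = p(z)` for all `p ∈ P`, the sum being over the `ξ ∈ Ξ` with
`W(ξ, z) > 0`. -/
def BGFeasible (P : Submodule ℝ (M → ℝ)) (Ξ : Finset M) (W : M → M → ℝ) (z : M)
    (c : Ξ → ℝ) : Prop :=
  ∀ p ∈ P, ∑ ξ ∈ Finset.univ.filter (fun ξ : Ξ => 0 < W ξ z), c ξ * p ξ = p z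

/-- `b = b*(·, z)` is a vector of values at `z` of the Backus–Gilbert shape functions: it
minimizes the Backus–Gilbert functional under the constraint. The entries with `W(ξ, z) = 0`,
which occur neither in the functional nor in the constraint, are zero by convention. -/
structure IsShapeVector (P : Submodule ℝ (M → ℝ)) (Ξ : Finset M) (W : M → M → ℝ) (z : M)
    (b : Ξ → ℝ) : Prop where
  eq_zero : ∀ ξ : Ξ, W ξ z = 0 → b ξ = 0
  feasible : BGFeasible P Ξ W z b
  minimal : ∀ c : Ξ → ℝ, BGFeasible P Ξ W z c → bgCost Ξ W z b ≤ bgCost Ξ W z c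

end Points

end MLS

end

set_option linter.unusedSectionVars false

noncomputable section

namespace MLS

/-! The minimizer costs no more than any competitor, so one good competitor suffices. The sample
points within `3κh ≤ c₀δ` of `z` form a norming set: if `|p| ≤ m` on them, then `|p z| ≤ 2m`
(`abs_le_two_mul_of_fill`). By Hahn–Banach, evaluation at `z` is then a combination of the
evaluations at these points with coefficients of ℓ¹-norm at most 2 (`exists_coeff_of_norming`). The
weight is at least `c₁` there, so the minimal cost is at most `4/c₁`. Cauchy–Schwarz with `W ≤ 1`
gives `(∑|b|)² ≤ (4/c₁) N`, where `N` is the number of sample points of positive weight. These are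
`q`-separated and lie in `B(z, δ)`, so comparing the volumes of disjoint balls bounds `N` by
`(β/α)(1 + 2δ/q)^d`.

For the norming inequality, let `|p|` attain its maximum over `Ω` near `z` at `x`. The cone
condition puts a ball of comparable size inside the region of the maximum; doubling carries the
bound `|p x|` from it to a full ball about `z`, and Markov's inequality then bounds the gradient
there. The definition of `κ` makes the oscillation of `p` between `x` and a nearby sample point at
most `|p x|/2`.

The bounds (1) come from charts: locally these are bi-Lipschitz with volume density bounded above
and below, so small balls have volume comparable to `r^d`. Compactness makes the constants uniform,
and the balls supplied by the cone condition give the lower bound inside `Ω`. -/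

/-- A vector at distance less than `s sin θ` from `s • v` lies in the cone about `v` of aperture
`θ`. -/
theorem norm_mul_cos_le_inner_of_norm_sub_lt {E : Type*} [NormedAddCommGroup E]
    [InnerProductSpace ℝ E] {v w : E} {s θ : ℝ} (hv : ‖v‖ = 1) (hs : 0 < s) (hθ₀ : 0 < θ)
    (hθ₁ : θ < Real.pi / 2) (hw : ‖w - s • v‖ < s * Real.sin θ) :
    ‖w‖ * Real.cos θ ≤ inner ℝ v w := by
  obtain ⟨e, rfl⟩ : ∃ e, w = s • v + e := ⟨w - s • v, by abel⟩
  rw [add_sub_cancel_left] at hw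
  have hsin : Real.sin θ ≤ 1 := Real.sin_le_one θ
  have hsin0 : 0 < Real.sin θ := Real.sin_pos_of_pos_of_lt_pi hθ₀ (by linarith [Real.pi_pos])
  have hcos : Real.cos θ ^ 2 = 1 - Real.sin θ ^ 2 := by linarith [Real.sin_sq_add_cos_sq θ]
  have hin : inner ℝ v (s • v + e) = s + inner ℝ v e := by
    rw [inner_add_right, real_inner_smul_right, real_inner_self_eq_norm_sq, hv]; ring
  have hnorm : ‖s • v + e‖ ^ 2 = s ^ 2 + 2 * s * inner ℝ v e + ‖e‖ ^ 2 := by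
    rw [norm_add_sq_real, norm_smul, hv, real_inner_smul_left, Real.norm_eq_abs, mul_one, sq_abs]
    ring
  have habs : |inner ℝ v e| ≤ ‖e‖ := by
    simpa [hv] using abs_real_inner_le_norm v e
  rw [hin]
  set a : ℝ := inner ℝ v e
  have ha := abs_le.1 habs
  have hsσ : s * Real.sin θ ≤ s := by nlinarith
  have he2 : ‖e‖ ^ 2 ≤ (s * Real.sin θ) ^ 2 := by gcongr
  refine abs_le_of_sq_le_sq' ?_ (by linarith [ha.1]) |>.2
  rw [mul_pow, hnorm, hcos]
  have h1 : 0 ≤ 1 - Real.sin θ ^ 2 := by nlinarith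
  -- With `‖e‖²` replaced by its bound `s² sin² θ`, the difference of the two sides is exactly the
  -- square `(a + s sin² θ)²`.
  nlinarith [mul_le_mul_of_nonneg_left he2 h1, sq_nonneg (a + Real.sin θ ^ 2 * s)]

/-! ### Balls inside geodesic cones. -/

section Cone

variable {d : ℕ} {M : Type*} [MetricSpace M] [ChartedSpace (EuclideanSpace ℝ (Fin d)) M]
  [IsManifold (𝓡 d) ∞ M] [RiemannianBundle (fun x : M => TangentSpace (𝓡 d) x)]
  {Ω : Set M} {rΩ Γ₁ Γ₂ rflat θ : ℝ}

theorem IsNormalRadius.expMap_zero (h : IsNormalRadius (d := d) Ω rΩ Γ₁ Γ₂) {z : M} (hz : z ∈ Ω) :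
    expMap z (0 : TangentSpace (𝓡 d) z) = z := by
  have := h.radial z hz 0 (by simpa using h.radius_pos)
  rw [norm_zero, dist_eq_zero] at this
  exact this.symm

/-- Radial distances are preserved exactly, so the lower distortion factor cannot exceed 1. A unit
vector is needed to have a nonzero radial segment to test. -/
theorem IsNormalRadius.lower_le_one (h : IsNormalRadius (d := d) Ω rΩ Γ₁ Γ₂) {z : M} (hz : z ∈ Ω)
    {v : TangentSpace (𝓡 d) z} (hv : ‖v‖ = 1) : Γ₁ ≤ 1 := by
  have h0 := h.radius_pos
  have hn : ‖(rΩ / 2) • v‖ = rΩ / 2 := by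
    rw [norm_smul, hv, mul_one, Real.norm_eq_abs, abs_of_pos (by linarith)]
  have h1 := h.lower z hz ((rΩ / 2) • v) 0 (by linarith) (by simpa using h0)
  have h2 := h.radial z hz ((rΩ / 2) • v) (by linarith)
  rw [h.expMap_zero hz, dist_comm, h2, sub_zero, hn] at h1
  nlinarith

theorem exists_dist_eq_of_cone (h : IsNormalRadius (d := d) Ω rΩ Γ₁ Γ₂)
    (hcone : InteriorCone d Ω rflat θ) {z : M} (hz : z ∈ Ω) {t : ℝ} (ht : 0 ≤ t) (ht1 : t < rΩ)
    (ht2 : t ≤ rflat) : ∃ y ∈ Ω, dist z y = t := by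
  obtain ⟨v, hv, hvc⟩ := hcone z hz
  have hn : ‖t • v‖ = t := by rw [norm_smul, hv, mul_one, Real.norm_eq_abs, abs_of_nonneg ht]
  refine ⟨expMap z (t • v), (hvc _ (by rwa [hn]) ?_).2, ?_⟩
  · rw [hn, real_inner_smul_right, real_inner_self_eq_norm_sq, hv]
    nlinarith [Real.cos_le_one θ]
  · rw [h.radial z hz _ (by rwa [hn]), hn]

theorem IsNormalRadius.lower_le_one_of_cone (h : IsNormalRadius (d := d) Ω rΩ Γ₁ Γ₂)
    (hcone : InteriorCone d Ω rflat θ) {z : M} (hz : z ∈ Ω) : Γ₁ ≤ 1 := by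
  obtain ⟨v, hv, -⟩ := hcone z hz
  exact h.lower_le_one hz hv

/-- In the tangent space, the ball of radius `s sin θ` about `s • v` lies in the cone, and `s = ρ/(1
+ sin θ)` is chosen so that it also lies in the ball of radius `ρ` about 0. Points near `Exp_z(s •
v)` are images of vectors, and the lower distortion bound puts these vectors in that tangent ball;
this costs the factor `Γ₁`. -/
theorem exists_ball_subset_of_cone (h : IsNormalRadius (d := d) Ω rΩ Γ₁ Γ₂)
    (hθ₀ : 0 < θ) (hθ₁ : θ < Real.pi / 2)
    (hcone : InteriorCone d Ω rflat θ) {z : M} (hz : z ∈ Ω) {ρ : ℝ} (hρ : 0 < ρ) (hρ1 : ρ < rΩ)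
    (hρ2 : ρ ≤ rflat) :
    ∃ y ∈ Ω, dist z y = ρ / (1 + Real.sin θ) ∧
      Metric.ball y (Γ₁ * Real.sin θ * (ρ / (1 + Real.sin θ))) ⊆ Ω ∩ Metric.closedBall z ρ := by
  obtain ⟨v, hv, hvc⟩ := hcone z hz
  have hΓ := h.lower_le_one hz hv
  have hΓ0 := h.lower_pos
  have hσ0 : 0 < Real.sin θ := Real.sin_pos_of_pos_of_lt_pi hθ₀ (by linarith [Real.pi_pos])
  set σ := Real.sin θ with hσ
  set s := ρ / (1 + σ) with hs
  have hs0 : 0 < s := by positivity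
  have hsρ : s + s * σ = ρ := by rw [hs]; field_simp
  have hn : ‖s • v‖ = s := by
    rw [norm_smul, hv, mul_one, Real.norm_eq_abs, abs_of_nonneg hs0.le]
  have hsσ : 0 < s * σ := by positivity
  have hmem : ∀ w : TangentSpace (𝓡 d) z, ‖w - s • v‖ < s * σ → ‖w‖ ≤ ρ ∧ expMap z w ∈ Ω := by
    intro w hw
    have hwn : ‖w‖ ≤ ρ := by
      have := norm_add_le (w - s • v) (s • v)
      rw [sub_add_cancel, hn] at this
      linarith
    exact ⟨hwn, (hvc w (hwn.trans hρ2)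
      (norm_mul_cos_le_inner_of_norm_sub_lt hv hs0 hθ₀ hθ₁ hw)).2⟩
  have hrad := h.radial z hz (s • v) (by rw [hn]; linarith)
  rw [hn] at hrad
  refine ⟨expMap z (s • v), (hmem _ (by simpa using hsσ)).2, hrad, ?_⟩
  intro x hx
  rw [Metric.mem_ball] at hx
  have hb : Γ₁ * σ * s ≤ s * σ := by nlinarith
  have hxz : x ∈ Metric.ball z rΩ := by
    rw [Metric.mem_ball]
    have := dist_triangle x (expMap z (s • v)) z
    rw [dist_comm (expMap z (s • v)) z, hrad] at this
    linarith
  obtain ⟨Φ, hΦs, hΦt, hΦ⟩ := h.diffeo z hz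
  rw [← hΦt] at hxz
  obtain ⟨w, hw, rfl⟩ : ∃ w : TangentSpace (𝓡 d) z, ‖w‖ < rΩ ∧ expMap z w = x := by
    have h1 := Φ.toPartialEquiv.map_target hxz
    have h2 := Φ.toPartialEquiv.right_inv hxz
    have h1' : Φ.toPartialEquiv.symm x ∈ {v : TangentSpace (𝓡 d) z | ‖v‖ < rΩ} := hΦs ▸ h1
    exact ⟨Φ.toPartialEquiv.symm x, h1', (hΦ _ h1').symm.trans h2⟩
  have hlow := h.lower z hz w (s • v) hw (by rw [hn]; linarith)
  have hw' : ‖w - s • v‖ < s * σ := by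
    have : Γ₁ * ‖w - s • v‖ < Γ₁ * (s * σ) := by linarith
    exact lt_of_mul_lt_mul_left this hΓ0.le
  obtain ⟨h1, h2⟩ := hmem w hw'
  refine ⟨h2, ?_⟩
  rw [Metric.mem_closedBall, dist_comm, h.radial z hz w hw]
  exact h1

end Cone

/-! ### Lipschitz estimates along paths. -/

section Length

variable {d : ℕ} {M : Type*} [MetricSpace M] [ChartedSpace (EuclideanSpace ℝ (Fin d)) M]
  [IsManifold (𝓡 d) ∞ M] [RiemannianBundle (fun x : M => TangentSpace (𝓡 d) x)]

/-- A `C¹` map whose differential is bounded by `G` along a `C¹` path increases its length by a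
factor of at most `G`. -/
theorem enorm_sub_le_mul_pathELength {F : Type*} [NormedAddCommGroup F] [NormedSpace ℝ F]
    {f : M → F} {s : Set M} {G : ℝ≥0} (hs : IsOpen s) (hf : ContMDiffOn (𝓡 d) 𝓘(ℝ, F) 1 f s)
    (hG : ∀ y ∈ s, ∀ v : TangentSpace (𝓡 d) y,
      enorm (E := F) (mfderiv (𝓡 d) 𝓘(ℝ, F) f y v) ≤ G * ‖v‖ₑ)
    {γ : ℝ → M} (hγ : ContMDiffOn 𝓘(ℝ, ℝ) (𝓡 d) 1 γ (Icc 0 1)) (hγs : ∀ t ∈ Icc (0 : ℝ) 1, γ t ∈ s) :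
    ‖f (γ 1) - f (γ 0)‖ₑ ≤ G * pathELength (𝓡 d) γ 0 1 := by
  have hC : ContMDiffOn 𝓘(ℝ, ℝ) 𝓘(ℝ, F) 1 (f ∘ γ) (Icc 0 1) := hf.comp hγ hγs
  calc
    ‖(f ∘ γ) 1 - (f ∘ γ) 0‖ₑ
    _ ≤ ∫⁻ t in Icc 0 1, ‖derivWithin (f ∘ γ) (Icc 0 1) t‖ₑ := by
      apply enorm_sub_le_lintegral_derivWithin_Icc_of_contDiffOn_Icc _ zero_le_one
      rwa [← contMDiffOn_iff_contDiffOn]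
    _ = ∫⁻ t in Icc 0 1, enorm (E := F)
        (mfderivWithin 𝓘(ℝ, ℝ) 𝓘(ℝ, F) (f ∘ γ) (Icc 0 1) t (1 : ℝ)) := by
      simp_rw [← fderivWithin_derivWithin, mfderivWithin_eq_fderivWithin]
      rfl
    _ ≤ ∫⁻ t in Icc 0 1, G * ‖(mfderivWithin 𝓘(ℝ, ℝ) (𝓡 d) γ (Icc 0 1) t (1 : ℝ) :
          TangentSpace (𝓡 d) (γ t))‖ₑ := by
      apply setLIntegral_mono' measurableSet_Icc (fun t ht ↦ ?_)
      have h1 : mfderivWithin 𝓘(ℝ, ℝ) 𝓘(ℝ, F) (f ∘ γ) (Icc 0 1) t =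
          (mfderiv (𝓡 d) 𝓘(ℝ, F) f (γ t)) ∘L (mfderivWithin 𝓘(ℝ, ℝ) (𝓡 d) γ (Icc 0 1) t) := by
        apply mfderiv_comp_mfderivWithin
        · exact ((hf _ (hγs t ht)).contMDiffAt (hs.mem_nhds (hγs t ht))).mdifferentiableAt
            one_ne_zero
        · exact hγ.mdifferentiableOn one_ne_zero _ ht
        · rw [uniqueMDiffWithinAt_iff_uniqueDiffWithinAt]
          exact uniqueDiffOn_Icc zero_lt_one _ ht
      rw [h1]
      exact hG _ (hγs t ht) _
    _ = G * pathELength (𝓡 d) γ 0 1 := by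
      rw [lintegral_const_mul' _ _ ENNReal.coe_ne_top,
          pathELength_eq_lintegral_mfderivWithin_Icc]
      rfl

/-- Two points at distance less than `L` are joined by a `C¹` path of length less than `L`, which
stays at distance less than `L` from its starting point. -/
theorem exists_path_of_dist_lt [IsRiemannianManifold (𝓡 d) M] {x y : M} {L : ℝ}
    (hL : dist x y < L) :
    ∃ γ : ℝ → M, γ 0 = x ∧ γ 1 = y ∧ ContMDiffOn 𝓘(ℝ, ℝ) (𝓡 d) 1 γ (Icc 0 1) ∧
      pathELength (𝓡 d) γ 0 1 < ENNReal.ofReal L ∧ ∀ t ∈ Icc (0 : ℝ) 1, dist x (γ t) < L := by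
  have hL0 : 0 < L := dist_nonneg.trans_lt hL
  have h1 : riemannianEDist (𝓡 d) x y < ENNReal.ofReal L := by
    rw [← IsRiemannianManifold.out, edist_dist]
    exact (ENNReal.ofReal_lt_ofReal_iff hL0).2 hL
  obtain ⟨γ, h0, h1, hγ, hlen⟩ := exists_lt_of_riemannianEDist_lt h1
  refine ⟨γ, h0, h1, hγ, hlen, fun t ht => ?_⟩
  rw [← ENNReal.ofReal_lt_ofReal_iff hL0, ← edist_dist, IsRiemannianManifold.out (I := 𝓡 d)]
  refine lt_of_le_of_lt ?_ hlen
  refine (riemannianEDist_le_pathELength (hγ.mono (Icc_subset_Icc_right ht.2)) h0 rfl ht.1).trans ?_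
  exact pathELength_mono le_rfl ht.2

/-- A nearly minimizing path from `x` to `y` stays within `L` of `x`, hence in the ball where the
differential is controlled. The strict bound `dist x y < L` replaces a minimizing geodesic, which
need not exist. -/
theorem norm_sub_le_of_mfderiv_le [IsRiemannianManifold (𝓡 d) M] {F : Type*}
    [NormedAddCommGroup F] [NormedSpace ℝ F] {f : M → F} {z : M} {R : ℝ} {G : ℝ≥0}
    (hf : ContMDiffOn (𝓡 d) 𝓘(ℝ, F) 1 f (Metric.ball z R))
    (hG : ∀ y ∈ Metric.ball z R, ∀ v : TangentSpace (𝓡 d) y,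
      enorm (E := F) (mfderiv (𝓡 d) 𝓘(ℝ, F) f y v) ≤ G * ‖v‖ₑ)
    {x y : M} {L : ℝ} (hL : dist x y < L) (hR : dist x z + L ≤ R) :
    ‖f x - f y‖ ≤ G * L := by
  have hL0 : 0 < L := dist_nonneg.trans_lt hL
  obtain ⟨γ, rfl, rfl, hγ, hlen, hd⟩ := exists_path_of_dist_lt (d := d) hL
  have h1 := enorm_sub_le_mul_pathELength Metric.isOpen_ball hf hG hγ (fun t ht => by
    rw [Metric.mem_ball]
    have := dist_triangle (γ t) (γ 0) z
    have := hd t ht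
    rw [dist_comm] at this
    linarith)
  have h2 : ‖f (γ 1) - f (γ 0)‖ₑ ≤ ENNReal.ofReal (G * L) := by
    refine h1.trans ?_
    rw [ENNReal.ofReal_mul G.coe_nonneg, ENNReal.ofReal_coe_nnreal]
    gcongr
  rw [norm_sub_rev]
  rw [← ofReal_norm, ENNReal.ofReal_le_ofReal_iff (by positivity)] at h2
  exact h2

end Length

/-! ### The norming inequality from doubling and Markov. -/

section Norming

theorem supNorm_mono {M : Type*} (p : M → ℝ) {s t : Set M} (h : s ⊆ t) :
    supNorm p s ≤ supNorm p t :=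
  biSup_mono h

theorem supNorm_le_ofReal {M : Type*} {p : M → ℝ} {s : Set M} {A : ℝ}
    (h : ∀ y ∈ s, |p y| ≤ A) : supNorm p s ≤ ENNReal.ofReal A := by
  refine iSup₂_le fun y hy => ?_
  rw [← ofReal_norm, Real.norm_eq_abs]
  exact ENNReal.ofReal_le_ofReal (h y hy)

variable {d : ℕ} {M : Type*} [MetricSpace M] [ChartedSpace (EuclideanSpace ℝ (Fin d)) M]
  [IsManifold (𝓡 d) ∞ M] [RiemannianBundle (fun x : M => TangentSpace (𝓡 d) x)]

theorem enorm_mfderiv_apply_le (p : M → ℝ) {s : Set M} {y : M} (hy : y ∈ s)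
    (v : TangentSpace (𝓡 d) y) :
    enorm (E := ℝ) (mfderiv (𝓡 d) 𝓘(ℝ, ℝ) p y v) ≤ gradSupNorm d p s * ‖v‖ₑ := by
  have h1 : ‖(mfderiv (𝓡 d) 𝓘(ℝ, ℝ) p y : TangentSpace (𝓡 d) y →L[ℝ] ℝ)‖ₑ ≤ gradSupNorm d p s :=
    le_iSup₂ (f := fun y (_ : y ∈ s) =>
      ‖(mfderiv (𝓡 d) 𝓘(ℝ, ℝ) p y : TangentSpace (𝓡 d) y →L[ℝ] ℝ)‖ₑ) y hy
  have h2 := ContinuousLinearMap.le_opENorm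
    (mfderiv (𝓡 d) 𝓘(ℝ, ℝ) p y : TangentSpace (𝓡 d) y →L[ℝ] ℝ) v
  have h3 : enorm (E := ℝ) (mfderiv (𝓡 d) 𝓘(ℝ, ℝ) p y v) = ‖mfderiv (𝓡 d) 𝓘(ℝ, ℝ) p y v‖ₑ :=
    (enorm_tangentSpace_vectorSpace (F := ℝ) (x := p y) (v := mfderiv (𝓡 d) 𝓘(ℝ, ℝ) p y v)).symm
  rw [h3]
  exact h2.trans (mul_le_mul_left h1 _)

variable {P : Submodule ℝ (M → ℝ)} {D K r₀ : ℝ}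

theorem DoublingMarkov.supNorm_ball_le_pow (h : DoublingMarkov d P D K r₀) {p : M → ℝ}
    (hp : p ∈ P) (y : M) {T : ℝ} (hT : 0 < T) (hT' : T / 2 < r₀) (k : ℕ) :
    supNorm p (Metric.ball y T) ≤
      ENNReal.ofReal (((2 : ℝ) ^ k) ^ D) * supNorm p (Metric.ball y (T / 2 ^ k)) := by
  induction k with
  | zero => simp
  | succ k ih =>
    refine ih.trans ?_
    have h1 : (1 : ℝ) ≤ 2 ^ k := one_le_pow₀ one_le_two
    have h2 : T / 2 ^ (k + 1) ≤ T / 2 := by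
      rw [pow_succ]
      gcongr
      linarith
    have h3 := h.doubling p hp (T / 2 ^ (k + 1)) (by positivity) (h2.trans_lt hT') y
    rw [show 2 * (T / 2 ^ (k + 1)) = T / 2 ^ k by field_simp; ring] at h3
    calc _ ≤ ENNReal.ofReal (((2 : ℝ) ^ k) ^ D) * (ENNReal.ofReal ((2 : ℝ) ^ D) *
          supNorm p (Metric.ball y (T / 2 ^ (k + 1)))) := by gcongr
      _ = _ := by
        rw [← mul_assoc, ← ENNReal.ofReal_mul (by positivity), pow_succ,
          Real.mul_rpow (by positivity) (by positivity)]

/-- The doubling inequality for concentric balls of arbitrary ratio. -/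
theorem DoublingMarkov.supNorm_ball_le (h : DoublingMarkov d P D K r₀) {p : M → ℝ}
    (hp : p ∈ P) (y : M) {t T : ℝ} (ht : 0 < t) (htT : t ≤ T) (hT' : T / 2 < r₀) :
    supNorm p (Metric.ball y T) ≤
      ENNReal.ofReal ((2 * (T / t)) ^ D) * supNorm p (Metric.ball y t) := by
  have hT : 0 < T := ht.trans_le htT
  -- Here `2^n ≤ T/t < 2^(n+1)`: `n + 1` halvings bring the radius below `t`, and rounding up costs
  -- the extra factor 2 inside the power.
  obtain ⟨n, hn1, hn2⟩ := exists_nat_pow_near ((one_le_div ht).2 htT) (one_lt_two (α := ℝ))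
  refine (h.supNorm_ball_le_pow hp y hT hT' (n + 1)).trans ?_
  refine mul_le_mul' (ENNReal.ofReal_le_ofReal ?_) (supNorm_mono p (Metric.ball_subset_ball ?_))
  · refine Real.rpow_le_rpow (by positivity) ?_ h.doubling_pos.le
    rw [pow_succ]
    linarith
  · rw [div_le_iff₀ (by positivity)]
    rw [div_lt_iff₀ ht] at hn2
    linarith

/-- Markov's inequality turns a sup bound on a ball into a Lipschitz bound for paths inside it. -/
theorem DoublingMarkov.norm_sub_le [IsRiemannianManifold (𝓡 d) M] (h : DoublingMarkov d P D K r₀)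
    {p : M → ℝ} (hp : p ∈ P) {z : M} {R A : ℝ} (hR : 0 < R) (hR' : R < r₀) (hA0 : 0 ≤ A)
    (hA : supNorm p (Metric.ball z R) ≤ ENNReal.ofReal A) {x y : M} {L : ℝ} (hL : dist x y < L)
    (hxR : dist x z + L ≤ R) : |p x - p y| ≤ K / R * A * L := by
  have hK := h.markov_pos
  have hG : gradSupNorm d p (Metric.ball z R) ≤ (Real.toNNReal (K / R * A) : ℝ≥0∞) := by
    refine (h.markov p hp R hR hR' z).trans ?_
    change _ ≤ ENNReal.ofReal (K / R * A)
    rw [ENNReal.ofReal_mul (by positivity)]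
    gcongr
  have h1 := norm_sub_le_of_mfderiv_le (d := d) (f := p) (z := z) (R := R)
    (G := Real.toNNReal (K / R * A))
    (h.contMDiff p hp).contMDiffOn (fun y hy v => (enorm_mfderiv_apply_le p hy v).trans (by gcongr))
    hL hxR
  rwa [Real.norm_eq_abs, Real.coe_toNNReal _ (by positivity)] at h1

variable {Ω : Set M} {rΩ Γ₁ Γ₂ rflat θ : ℝ}

theorem two_le_of_le_kappa {a κ : ℝ} (ha0 : 0 < a) (ha1 : a ≤ 1) (hκ : (1 + a) / a ≤ κ) :
    2 ≤ κ := by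
  refine le_trans ?_ hκ
  rw [le_div_iff₀ ha0]
  linarith

/-- The points of a sufficiently dense set that lie in the ball of radius `3 κ h` about `z` form a
norming set for the evaluation at `z`, with constant `2`. -/
theorem abs_le_two_mul_of_fill [IsRiemannianManifold (𝓡 d) M] (hΩ : IsCompact Ω)
    (hN : IsNormalRadius (d := d) Ω rΩ Γ₁ Γ₂) (hθ₀ : 0 < θ) (hθ₁ : θ < Real.pi / 2)
    (hcone : InteriorCone d Ω rflat θ) (hP : DoublingMarkov d P D K r₀)
    (hκ : (1 + Γ₁ * Real.sin θ) / (Γ₁ * Real.sin θ) ≤ kappa D K Γ₁ θ)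
    {Ξ : Set M} {h : ℝ} (hh : 0 < h) (hfill : ∀ x ∈ Ω, ∃ ξ ∈ Ξ, dist x ξ ≤ h)
    (h1 : 3 * kappa D K Γ₁ θ * h ≤ rΩ) (h2 : 3 * kappa D K Γ₁ θ * h ≤ rflat)
    (h3 : 3 * kappa D K Γ₁ θ * h ≤ r₀) {z : M} (hz : z ∈ Ω) {p : M → ℝ} (hp : p ∈ P) {m : ℝ}
    (hm : ∀ ξ ∈ Ξ, dist ξ z ≤ 3 * kappa D K Γ₁ θ * h → |p ξ| ≤ m) : |p z| ≤ 2 * m := by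
  have hΓ1 := hN.lower_le_one_of_cone hcone hz
  have hΓ0 := hN.lower_pos
  have hK := hP.markov_pos
  have hD := hP.doubling_pos
  have hσ0 : 0 < Real.sin θ := Real.sin_pos_of_pos_of_lt_pi hθ₀ (by linarith [Real.pi_pos])
  have hσ1 : Real.sin θ ≤ 1 := Real.sin_le_one θ
  have hκ2 : 2 ≤ kappa D K Γ₁ θ := two_le_of_le_kappa (by positivity) (by nlinarith) hκ
  set κ := kappa D K Γ₁ θ with hκdef
  set σ := Real.sin θ with hσ
  -- The radii leave room for what follows: a path of length `3h/2` from `B(z, ρ)` stays in `B(z,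
  -- R')`, since `ρ + 3h/2 = R'`, and a sample point within `h` of `B(z, ρ)` is within `R` of `z`.
  -- The strict `R' < R` provides the strict bound on radii in the doubling and Markov inequalities.
  set R := 3 * κ * h with hRdef
  have hR6 : 6 * h ≤ R := by nlinarith
  set ρ := R - 2 * h with hρdef
  set R' := R - h / 2 with hR'def
  have hR'ρ : R' ≤ 2 * ρ := by linarith
  have hρ0 : 0 < ρ := by linarith
  have hR'0 : 0 < R' := by linarith
  obtain ⟨y, hyΩ, hyz, hball⟩ := exists_ball_subset_of_cone hN hθ₀ hθ₁ hcone hz hρ0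
    (by linarith) (by linarith)
  set s := ρ / (1 + σ) with hs
  set t := Γ₁ * σ * s with ht
  have hs0 : 0 < s := by positivity
  have ht0 : 0 < t := by positivity
  have hsρ : s ≤ ρ := div_le_self hρ0.le (by linarith)
  have hts : t ≤ s := by
    have : Γ₁ * σ ≤ 1 := by nlinarith
    nlinarith
  obtain ⟨x, hx, hmax⟩ := (hΩ.inter_right (Metric.isClosed_closedBall (x := z) (ε := ρ))).exists_isMaxOn
    ⟨z, hz, Metric.mem_closedBall_self hρ0.le⟩
    ((hP.contMDiff p hp).continuous.abs.continuousOn)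
  have hzx : |p z| ≤ |p x| := hmax ⟨hz, Metric.mem_closedBall_self hρ0.le⟩
  obtain ⟨ξ, hξ, hxξ⟩ := hfill x hx.1
  have hxz : dist x z ≤ ρ := hx.2
  have hξz : dist ξ z ≤ R := by
    have := dist_triangle ξ x z
    rw [dist_comm ξ x] at this
    linarith
  have hsmall : supNorm p (Metric.ball y t) ≤ ENNReal.ofReal |p x| :=
    supNorm_le_ofReal fun w hw => hmax (hball hw)
  have hbig : supNorm p (Metric.ball z R') ≤
      ENNReal.ofReal ((2 * ((s + R') / t)) ^ D * |p x|) := by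
    refine (supNorm_mono p (t := Metric.ball y (s + R')) ?_).trans ?_
    · refine Metric.ball_subset_ball' ?_
      rw [hyz, add_comm]
    · refine (hP.supNorm_ball_le hp y ht0 (by linarith) (by linarith)).trans ?_
      rw [ENNReal.ofReal_mul (by positivity)]
      gcongr
  have hdiff := hP.norm_sub_le hp hR'0 (by linarith) (by positivity) hbig
    (L := 3 / 2 * h) (x := x) (y := ξ) (by linarith) (by linarith)
  -- By `R' ≤ 2ρ`, the numerator `ρ + (1 + σ)R'` is at most `(3 + 2σ)ρ ≤ 2(2 + σ)ρ`.
  have hratio : 2 * ((s + R') / t) ≤ 4 * ((2 + σ) / (Γ₁ * σ)) := by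
    have e1 : (s + R') / t = (ρ + (1 + σ) * R') / (Γ₁ * σ * ρ) := by
      rw [ht, hs]; field_simp
    have e2 : 2 * ((2 + σ) / (Γ₁ * σ)) = (2 * (2 + σ) * ρ) / (Γ₁ * σ * ρ) := by field_simp
    have : (s + R') / t ≤ 2 * ((2 + σ) / (Γ₁ * σ)) := by
      rw [e1, e2]
      gcongr
      nlinarith
    linarith
  have hpow : (2 * ((s + R') / t)) ^ D ≤ (2 : ℝ) ^ (2 * D) * ((2 + σ) / (Γ₁ * σ)) ^ D := by
    have e4 : (4 : ℝ) ^ D = (2 : ℝ) ^ (2 * D) := by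
      rw [Real.rpow_mul (by norm_num)]; norm_num
    rw [← e4, ← Real.mul_rpow (by norm_num) (by positivity)]
    exact Real.rpow_le_rpow (by positivity) hratio hD.le
  -- The last factor of `κ` is `1 + 1/(Γ₁ sin θ) ≥ 2`, which yields the half.
  have hfac : K * (2 * ((s + R') / t)) ^ D ≤ κ / 2 := by
    have e5 : 2 ≤ (1 + Γ₁ * σ) / (Γ₁ * σ) :=
      two_le_of_le_kappa (a := Γ₁ * σ) (by positivity) (by nlinarith) le_rfl
    have e6 : κ = K * ((2 : ℝ) ^ (2 * D) * ((2 + σ) / (Γ₁ * σ)) ^ D) *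
        ((1 + Γ₁ * σ) / (Γ₁ * σ)) := by rw [hκdef, kappa]; ring
    have e7 : 0 ≤ K * ((2 : ℝ) ^ (2 * D) * ((2 + σ) / (Γ₁ * σ)) ^ D) := by positivity
    have e8 := mul_le_mul_of_nonneg_left hpow hK.le
    have e9 := mul_le_mul_of_nonneg_left e5 e7
    rw [← e6] at e9
    linarith
  have hhalf : K / R' * ((2 * ((s + R') / t)) ^ D * |p x|) * (3 / 2 * h) ≤ |p x| / 2 := by
    have e9 : K / R' * ((2 * ((s + R') / t)) ^ D * |p x|) * (3 / 2 * h) =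
        (K * (2 * ((s + R') / t)) ^ D) * (3 / 2 * h) * |p x| / R' := by ring
    rw [e9, div_le_iff₀ hR'0]
    -- The left side is at most `(κ/2)(3h/2) = R/4`, and `R ≤ 2R'`.
    have e10 : (K * (2 * ((s + R') / t)) ^ D) * (3 / 2 * h) ≤ R' / 2 := by
      have := mul_le_mul_of_nonneg_right hfac (show 0 ≤ 3 / 2 * h by positivity)
      linarith
    have e11 := mul_le_mul_of_nonneg_right e10 (abs_nonneg (p x))
    linarith
  have hξm := hm ξ hξ hξz
  have := abs_sub_abs_le_abs_sub (p x) (p ξ)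
  linarith

end Norming

/-! ### Hahn–Banach duality for norming sets. -/

section Duality

/-- If point evaluations at the `x i` norm the evaluation at `z` on `P` with constant `C`, then the
evaluation at `z` is a combination of those at the `x i` with coefficients of `ℓ¹`-norm at
most `C`. -/
theorem exists_coeff_of_norming {M ι : Type*} [Fintype ι] (P : Submodule ℝ (M → ℝ)) (x : ι → M)
    (z : M) {C : ℝ} (hC : 0 ≤ C)
    (h : ∀ p ∈ P, ∀ m : ℝ, 0 ≤ m → (∀ i, |p (x i)| ≤ m) → |p z| ≤ C * m) :
    ∃ a : ι → ℝ, (∀ p ∈ P, ∑ i, a i * p (x i) = p z) ∧ ∑ i, |a i| ≤ C := by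
  classical
  let L : P →ₗ[ℝ] (ι → ℝ) := (LinearMap.funLeft ℝ ℝ x) ∘ₗ P.subtype
  let ev : P →ₗ[ℝ] ℝ := (LinearMap.proj z) ∘ₗ P.subtype
  have hbound : ∀ p : P, |ev p| ≤ C * ‖L p‖ := fun p =>
    h p p.2 _ (norm_nonneg _) fun i => norm_le_pi_norm (L p) i
  have hker : LinearMap.ker L ≤ LinearMap.ker ev := by
    intro p hp
    have := hbound p
    rw [LinearMap.mem_ker.1 hp, norm_zero, mul_zero] at this
    exact LinearMap.mem_ker.2 (abs_nonpos_iff.1 this)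
  -- The norming bound forces evaluation at `z` to factor through the vector of samples. The factor
  -- is bounded by `C` for the sup norm and so extends to all of `ι → ℝ`, whose dual norm is the
  -- ℓ¹-norm.
  let f : LinearMap.range L →ₗ[ℝ] ℝ :=
    ((LinearMap.ker L).liftQ ev hker) ∘ₗ (L.quotKerEquivRange.symm : _ →ₗ[ℝ] _)
  have hf : ∀ p : P, f ⟨L p, LinearMap.mem_range_self L p⟩ = ev p := by
    intro p
    have : L.quotKerEquivRange.symm ⟨L p, LinearMap.mem_range_self L p⟩ =
        (LinearMap.ker L).mkQ p := by
      rw [LinearEquiv.symm_apply_eq]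
      rfl
    simp only [f, LinearMap.comp_apply, LinearEquiv.coe_coe, this]
    exact Submodule.liftQ_apply _ _ _
  have hfb : ∀ y, ‖f y‖ ≤ C * ‖y‖ := by
    rintro ⟨_, p, rfl⟩
    rw [hf]
    exact hbound p
  obtain ⟨g, hg, hgn⟩ := exists_extension_norm_eq (LinearMap.range L) (f.mkContinuous C hfb)
  have hgC : ‖g‖ ≤ C := hgn.trans_le (f.mkContinuous_norm_le hC hfb)
  have hsum : ∀ c : ι → ℝ, g c = ∑ i, g (Pi.single i 1) * c i := by
    intro c
    conv_lhs => rw [pi_eq_sum_univ' c, map_sum]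
    refine Finset.sum_congr rfl fun i _ => ?_
    rw [map_smul, smul_eq_mul, mul_comm]
  refine ⟨fun i => g (Pi.single i 1), fun p hp => ?_, ?_⟩
  · have h1 := hg ⟨L ⟨p, hp⟩, LinearMap.mem_range_self L _⟩
    rw [LinearMap.mkContinuous_apply, hf, hsum] at h1
    exact h1
  · have h1 : ∑ i, |g (Pi.single i 1)| = g fun i => SignType.sign (g (Pi.single i 1)) := by
      rw [hsum]
      exact Finset.sum_congr rfl fun i _ => (self_mul_sign _).symm
    rw [h1]
    refine (le_abs_self _).trans ((g.le_opNorm _).trans ?_)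
    refine (mul_le_of_le_one_right (norm_nonneg _) ?_).trans hgC
    refine (pi_norm_le_iff_of_nonneg zero_le_one).2 fun i => ?_
    rcases lt_trichotomy (g (Pi.single i 1)) 0 with hs | hs | hs <;> simp [hs]

end Duality

/-! ### Existence, uniqueness and cost of the shape vector. -/

section BackusGilbert

variable {M : Type*} [MetricSpace M] {P : Submodule ℝ (M → ℝ)} {Ξ : Finset M} {W : M → M → ℝ}
  {z : M}

open Classical in
theorem bgCost_congr {c c' : Ξ → ℝ} (h : ∀ ξ : Ξ, 0 < W ξ z → c ξ = c' ξ) :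
    bgCost Ξ W z c = bgCost Ξ W z c' :=
  Finset.sum_congr rfl fun ξ hξ => by rw [h ξ (Finset.mem_filter.1 hξ).2]

open Classical in
theorem BGFeasible.congr {c c' : Ξ → ℝ} (h : ∀ ξ : Ξ, 0 < W ξ z → c ξ = c' ξ)
    (hc : BGFeasible P Ξ W z c) : BGFeasible P Ξ W z c' := fun p hp => by
  rw [← hc p hp]
  exact Finset.sum_congr rfl fun ξ hξ => by rw [h ξ (Finset.mem_filter.1 hξ).2]

theorem continuous_bgCost : Continuous (bgCost Ξ W z) := by
  unfold bgCost
  fun_prop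

theorem sq_div_le_bgCost (c : Ξ → ℝ) {ξ : Ξ} (hξ : 0 < W ξ z) :
    1 / W ξ z * |c ξ| ^ 2 ≤ bgCost Ξ W z c := by
  classical
  refine Finset.single_le_sum (f := fun ξ : Ξ => 1 / W ξ z * |c ξ| ^ 2) (fun η hη => ?_)
    (Finset.mem_filter.2 ⟨Finset.mem_univ _, hξ⟩)
  have := (Finset.mem_filter.1 hη).2
  positivity

theorem isClosed_setOf_bgFeasible : IsClosed {c : Ξ → ℝ | BGFeasible P Ξ W z c} := by
  have : {c : Ξ → ℝ | BGFeasible P Ξ W z c} = ⋂ p ∈ P, {c | ∑ ξ ∈ Finset.univ.filter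
      (fun ξ : Ξ => 0 < W ξ z), c ξ * p ξ = p z} := by
    ext c
    simp [BGFeasible]
  rw [this]
  exact isClosed_biInter fun p _ => isClosed_eq (by fun_prop) continuous_const

/-- The Backus–Gilbert functional attains its minimum. -/
theorem exists_isShapeVector (hW0 : ∀ ξ : Ξ, 0 ≤ W ξ z) (hW1 : ∀ ξ : Ξ, W ξ z ≤ 1) {a : Ξ → ℝ}
    (ha : BGFeasible P Ξ W z a) : ∃ b : Ξ → ℝ, IsShapeVector P Ξ W z b := by
  classical
  -- Entries of zero weight affect neither the cost nor the constraint. Setting them to 0 is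
  -- harmless and makes the sublevel set bounded.
  let trunc : (Ξ → ℝ) → Ξ → ℝ := fun c ξ => if 0 < W ξ z then c ξ else 0
  have htr : ∀ c, ∀ ξ : Ξ, 0 < W ξ z → c ξ = trunc c ξ := fun c ξ hξ => by simp [trunc, hξ]
  have htr0 : ∀ c, ∀ ξ : Ξ, W ξ z = 0 → trunc c ξ = 0 := fun c ξ hξ => by simp [trunc, hξ]
  let T : Set (Ξ → ℝ) := ({c | BGFeasible P Ξ W z c} ∩ ⋂ ξ : Ξ, {c | W ξ z = 0 → c ξ = 0}) ∩
    {c | bgCost Ξ W z c ≤ bgCost Ξ W z a}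
  have hclosed : IsClosed T := by
    refine (isClosed_setOf_bgFeasible.inter (isClosed_iInter fun ξ => ?_)).inter
      (isClosed_le continuous_bgCost continuous_const)
    by_cases hξ : W ξ z = 0
    · simpa [hξ] using isClosed_eq (continuous_apply ξ) continuous_const
    · simp [hξ]
  have hcompact : IsCompact T := by
    refine (isCompact_univ_pi fun _ : Ξ => isCompact_Icc (a := -(1 + bgCost Ξ W z a))
      (b := 1 + bgCost Ξ W z a)).of_isClosed_subset hclosed ?_
    rintro c ⟨⟨-, hc0⟩, hc⟩ ξ -
    refine abs_le.1 ?_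
    rcases (hW0 ξ).eq_or_lt with h0 | h0
    · have : c ξ = 0 := Set.mem_iInter.1 hc0 ξ h0.symm
      rw [this, abs_zero]
      have : 0 ≤ bgCost Ξ W z a := Finset.sum_nonneg fun η hη => by
        have := (Finset.mem_filter.1 hη).2
        positivity
      linarith
    · have h1 := (sq_div_le_bgCost c h0).trans hc
      have h2 : 1 ≤ 1 / W ξ z := (one_le_div h0).2 (hW1 ξ)
      have h3 : |c ξ| ^ 2 ≤ 1 / W ξ z * |c ξ| ^ 2 := le_mul_of_one_le_left (by positivity) h2
      -- Weights at most 1 give `|c ξ|² ≤` cost of `a`, and `2t ≤ 1 + t²` then gives the linear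
      -- bound.
      nlinarith [sq_nonneg (|c ξ| - 1)]
  obtain ⟨b, hb, hmin⟩ := hcompact.exists_isMinOn
    ⟨trunc a, ⟨ha.congr (htr a), Set.mem_iInter.2 (htr0 a)⟩, (bgCost_congr (htr a)).ge⟩
    continuous_bgCost.continuousOn
  refine ⟨b, Set.mem_iInter.1 hb.1.2, hb.1.1, fun c hc => ?_⟩
  rcases le_total (bgCost Ξ W z c) (bgCost Ξ W z a) with h | h
  · rw [bgCost_congr (htr c)] at h ⊢
    exact hmin ⟨⟨hc.congr (htr c), Set.mem_iInter.2 (htr0 c)⟩, h⟩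
  · exact le_trans hb.2 h

/-- Strict convexity: by the parallelogram identity, the midpoint of two minimizers would cost less
by the cost of half their difference, so that cost vanishes. -/
theorem IsShapeVector.unique (hW0 : ∀ ξ : Ξ, 0 ≤ W ξ z) {b b' : Ξ → ℝ}
    (hb : IsShapeVector P Ξ W z b) (hb' : IsShapeVector P Ξ W z b') : b' = b := by
  classical
  have hmid : BGFeasible P Ξ W z (fun ξ => (b ξ + b' ξ) / 2) := by
    intro p hp
    have h1 := hb.feasible p hp
    have h2 := hb'.feasible p hp
    have h3 : ∀ ξ : Ξ, (b ξ + b' ξ) / 2 * p ξ = (b ξ * p ξ + b' ξ * p ξ) / 2 := fun ξ => by ring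
    simp_rw [h3]
    rw [← Finset.sum_div, Finset.sum_add_distrib, h1, h2]
    ring
  have h1 := hb.minimal _ hmid
  have h2 := hb'.minimal _ hmid
  have hpar : bgCost Ξ W z (fun ξ => (b ξ + b' ξ) / 2) + bgCost Ξ W z (fun ξ => (b' ξ - b ξ) / 2) =
      (bgCost Ξ W z b + bgCost Ξ W z b') / 2 := by
    unfold bgCost
    rw [← Finset.sum_add_distrib, ← Finset.sum_add_distrib, Finset.sum_div]
    refine Finset.sum_congr rfl fun ξ _ => ?_
    simp only [sq_abs]
    ring
  have h3 : bgCost Ξ W z (fun ξ => (b' ξ - b ξ) / 2) ≤ 0 := by linarith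
  ext ξ
  rcases (hW0 ξ).eq_or_lt with h0 | h0
  · rw [hb.eq_zero ξ h0.symm, hb'.eq_zero ξ h0.symm]
  · have h4 := (sq_div_le_bgCost (fun ξ => (b' ξ - b ξ) / 2) h0).trans h3
    have h5 : (b' ξ - b ξ) ^ 2 ≤ 0 := by
      have h6 : |(b' ξ - b ξ) / 2| ^ 2 ≤ 0 := nonpos_of_mul_nonpos_right h4 (by positivity)
      rw [sq_abs] at h6
      linarith [h6, show ((b' ξ - b ξ) / 2) ^ 2 = (b' ξ - b ξ) ^ 2 / 4 by ring]
    have := pow_eq_zero_iff (two_ne_zero) |>.1 (le_antisymm h5 (sq_nonneg _))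
    linarith

theorem bgCost_le_of_le {a : Ξ → ℝ} {c₁ C : ℝ} (hc₁ : 0 < c₁)
    (ha : ∀ ξ : Ξ, a ξ ≠ 0 → c₁ ≤ W ξ z) (haC : ∑ ξ, |a ξ| ≤ C) :
    bgCost Ξ W z a ≤ C ^ 2 / c₁ := by
  classical
  have h0 : 0 ≤ ∑ ξ, |a ξ| := Finset.sum_nonneg fun _ _ => abs_nonneg _
  calc bgCost Ξ W z a
      ≤ ∑ ξ ∈ Finset.univ.filter (fun ξ : Ξ => 0 < W ξ z), 1 / c₁ * |a ξ| ^ 2 := by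
        refine Finset.sum_le_sum fun ξ _ => ?_
        by_cases h : a ξ = 0
        · simp [h]
        · have := ha ξ h
          gcongr
    _ ≤ ∑ ξ, 1 / c₁ * |a ξ| ^ 2 :=
        Finset.sum_le_univ_sum_of_nonneg fun ξ => by positivity
    _ = 1 / c₁ * ∑ ξ, |a ξ| ^ 2 := by rw [Finset.mul_sum]
    _ ≤ 1 / c₁ * (∑ ξ, |a ξ|) ^ 2 := by
        gcongr
        exact Finset.sum_sq_le_sq_sum_of_nonneg fun _ _ => abs_nonneg _
    _ ≤ 1 / c₁ * C ^ 2 := by gcongr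
    _ = C ^ 2 / c₁ := by ring

open Classical in
/-- Cauchy–Schwarz: the `ℓ¹`-norm of a vector of small Backus–Gilbert cost. -/
theorem sum_abs_sq_le_bgCost_mul_card (hW0 : ∀ ξ : Ξ, 0 ≤ W ξ z) (hW1 : ∀ ξ : Ξ, W ξ z ≤ 1)
    {b : Ξ → ℝ} (hb : ∀ ξ : Ξ, W ξ z = 0 → b ξ = 0) :
    (∑ ξ, |b ξ|) ^ 2 ≤
      bgCost Ξ W z b * (Finset.univ.filter (fun ξ : Ξ => 0 < W ξ z)).card := by
  have h1 : ∑ ξ, |b ξ| = ∑ ξ ∈ Finset.univ.filter (fun ξ : Ξ => 0 < W ξ z), |b ξ| := by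
    refine (Finset.sum_subset (Finset.filter_subset _ _) fun ξ _ hξ => ?_).symm
    have : W ξ z = 0 := le_antisymm (by simpa using hξ) (hW0 ξ)
    rw [hb ξ this, abs_zero]
  have h2 := Finset.sum_sq_le_sum_mul_sum_of_sq_le_mul
    (Finset.univ.filter (fun ξ : Ξ => 0 < W ξ z)) (r := fun ξ => |b ξ|)
    (f := fun ξ => 1 / W ξ z * |b ξ| ^ 2) (g := fun ξ => W ξ z)
    (fun ξ hξ => by have := (Finset.mem_filter.1 hξ).2; positivity)
    (fun ξ hξ => hW0 ξ)
    (fun ξ hξ => by have := (Finset.mem_filter.1 hξ).2; field_simp; rfl)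
  rw [h1]
  refine h2.trans ?_
  unfold bgCost
  refine mul_le_mul_of_nonneg_left ?_ (Finset.sum_nonneg fun ξ hξ => by
    have := (Finset.mem_filter.1 hξ).2; positivity)
  refine (Finset.sum_le_sum fun ξ _ => hW1 ξ).trans ?_
  simp

end BackusGilbert

/-! ### Gram determinants. -/

section Gram

variable {d : ℕ}

/-- The Gram matrix of a bilinear form with respect to the standard basis. -/
def gram (B : LinearMap.BilinForm ℝ (EuclideanSpace ℝ (Fin d))) : Matrix (Fin d) (Fin d) ℝ :=
  Matrix.of fun i j => B (EuclideanSpace.single i (1 : ℝ)) (EuclideanSpace.single j (1 : ℝ))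

theorem gram_eq_toMatrix (B : LinearMap.BilinForm ℝ (EuclideanSpace ℝ (Fin d))) :
    gram B = LinearMap.BilinForm.toMatrix (EuclideanSpace.basisFun (Fin d) ℝ).toBasis B := by
  ext i j
  simp [gram, LinearMap.BilinForm.toMatrix_apply]

theorem det_gram_comp (B : LinearMap.BilinForm ℝ (EuclideanSpace ℝ (Fin d)))
    (A : EuclideanSpace ℝ (Fin d) →L[ℝ] EuclideanSpace ℝ (Fin d)) :
    (gram (B.comp A.toLinearMap A.toLinearMap)).det = A.det ^ 2 * (gram B).det := by
  have hA : A.det = (LinearMap.toMatrix (EuclideanSpace.basisFun (Fin d) ℝ).toBasis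
      (EuclideanSpace.basisFun (Fin d) ℝ).toBasis A.toLinearMap).det :=
    (LinearMap.det_toMatrix _ _).symm
  rw [gram_eq_toMatrix, gram_eq_toMatrix, LinearMap.BilinForm.toMatrix_comp
    (EuclideanSpace.basisFun (Fin d) ℝ).toBasis, Matrix.det_mul, Matrix.det_mul,
    Matrix.det_transpose, hA]
  ring

/-- The eigenvalues are the values of the form at unit eigenvectors, hence lie in `[c, C]`; the
determinant is the product of `d` of them. -/
theorem det_gram_mem_Icc (B : LinearMap.BilinForm ℝ (EuclideanSpace ℝ (Fin d)))
    (hsymm : ∀ u w, B u w = B w u) {c C : ℝ} (hc : 0 ≤ c) (hlow : ∀ u, c * ‖u‖ ^ 2 ≤ B u u)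
    (hup : ∀ u, B u u ≤ C * ‖u‖ ^ 2) : c ^ d ≤ (gram B).det ∧ (gram B).det ≤ C ^ d := by
  have hH : (gram B).IsHermitian := by
    ext i j
    simp [gram, hsymm]
  have heig : ∀ i, hH.eigenvalues i = B (hH.eigenvectorBasis i) (hH.eigenvectorBasis i) := by
    intro i
    rw [hH.eigenvalues_eq, LinearMap.BilinForm.apply_eq_dotProduct_toMatrix_mulVec
      (EuclideanSpace.basisFun (Fin d) ℝ).toBasis, ← gram_eq_toMatrix]
    simp
    rfl
  have hn : ∀ i, ‖hH.eigenvectorBasis i‖ = 1 := fun i => hH.eigenvectorBasis.orthonormal.1 i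
  have h1 : ∀ i, c ≤ hH.eigenvalues i := fun i => by
    rw [heig]; simpa [hn] using hlow (hH.eigenvectorBasis i)
  have h2 : ∀ i, hH.eigenvalues i ≤ C := fun i => by
    rw [heig]; simpa [hn] using hup (hH.eigenvectorBasis i)
  rw [hH.det_eq_prod_eigenvalues]
  simp only [RCLike.ofReal_real_eq_id, id]
  constructor
  · calc c ^ d = ∏ _i : Fin d, c := by simp
      _ ≤ _ := Finset.prod_le_prod (fun _ _ => hc) fun i _ => h1 i
  · calc _ ≤ ∏ _i : Fin d, C := Finset.prod_le_prod (fun i _ => hc.trans (h1 i)) fun i _ => h2 i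
      _ = C ^ d := by simp

end Gram

/-! ### The volume density under change of chart. -/

section Density

variable {d : ℕ} {M : Type*} [MetricSpace M] [ChartedSpace (EuclideanSpace ℝ (Fin d)) M]
  [IsManifold (𝓡 d) ∞ M] [RiemannianBundle (fun x : M => TangentSpace (𝓡 d) x)]

/-- The Riemannian metric at `p` as a bilinear form on the model space. -/
def metricForm (p : M) : LinearMap.BilinForm ℝ (EuclideanSpace ℝ (Fin d)) :=
  LinearMap.mk₂ ℝ (fun u w => inner (E := TangentSpace (𝓡 d) p) ℝ u w)
    (fun u v w => inner_add_left (E := TangentSpace (𝓡 d) p) u v w)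
    (fun c u w => real_inner_smul_left (F := TangentSpace (𝓡 d) p) u w c)
    (fun u v w => inner_add_right (E := TangentSpace (𝓡 d) p) u v w)
    (fun c u w => real_inner_smul_right (F := TangentSpace (𝓡 d) p) u w c)

/-- The differential of the inverse of the preferred chart at `x`, as an endomorphism of the model
space. -/
def dchartSymm (x : M) (y : EuclideanSpace ℝ (Fin d)) :
    EuclideanSpace ℝ (Fin d) →L[ℝ] EuclideanSpace ℝ (Fin d) :=
  mfderiv (𝓡 d) (𝓡 d) (extChartAt (𝓡 d) x).symm y

theorem chartDensity_eq (x : M) (y : EuclideanSpace ℝ (Fin d)) :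
    chartDensity x y = Real.sqrt (gram ((metricForm ((extChartAt (𝓡 d) x).symm y)).comp
      (dchartSymm x y).toLinearMap (dchartSymm x y).toLinearMap)).det :=
  rfl

theorem mdifferentiableAt_extChartAt_symm_of_mem {x : M} {y : EuclideanSpace ℝ (Fin d)}
    (hy : y ∈ (extChartAt (𝓡 d) x).target) :
    MDifferentiableAt (𝓡 d) (𝓡 d) (extChartAt (𝓡 d) x).symm y := by
  have := mdifferentiableWithinAt_extChartAt_symm hy
  rw [(𝓡 d).range_eq_univ] at this
  exact mdifferentiableWithinAt_univ.1 this

/-- The transition map between the preferred charts at `x` and `x'`. -/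
def transition (x x' : M) : EuclideanSpace ℝ (Fin d) → EuclideanSpace ℝ (Fin d) :=
  extChartAt (𝓡 d) x' ∘ (extChartAt (𝓡 d) x).symm

theorem isOpen_transition_domain (x x' : M) : IsOpen ((extChartAt (𝓡 d) x).target ∩
    (extChartAt (𝓡 d) x).symm ⁻¹' (extChartAt (𝓡 d) x').source) :=
  (continuousOn_extChartAt_symm x).isOpen_inter_preimage (isOpen_extChartAt_target x)
    (isOpen_extChartAt_source x')

theorem differentiableAt_transition {x x' : M} {y : EuclideanSpace ℝ (Fin d)}
    (hy : y ∈ (extChartAt (𝓡 d) x).target)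
    (hy' : (extChartAt (𝓡 d) x).symm y ∈ (extChartAt (𝓡 d) x').source) :
    DifferentiableAt ℝ (transition x x') y := by
  have h1 := contDiffOn_ext_coord_change (I := 𝓡 d) (n := ∞) x' x
  have h2 : ((extChartAt (𝓡 d) x).symm ≫ extChartAt (𝓡 d) x').source =
      (extChartAt (𝓡 d) x).target ∩
        (extChartAt (𝓡 d) x).symm ⁻¹' (extChartAt (𝓡 d) x').source := rfl
  rw [h2] at h1
  exact (h1.contDiffAt ((isOpen_transition_domain x x').mem_nhds ⟨hy, hy'⟩)).differentiableAt
    (by simp)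

theorem dchartSymm_eq_comp {x x' : M} {y : EuclideanSpace ℝ (Fin d)}
    (hy : y ∈ (extChartAt (𝓡 d) x).target)
    (hy' : (extChartAt (𝓡 d) x).symm y ∈ (extChartAt (𝓡 d) x').source) :
    dchartSymm x y = (dchartSymm x' (transition x x' y)).comp (fderiv ℝ (transition x x') y) := by
  have h1 : (extChartAt (𝓡 d) x).symm =ᶠ[𝓝 y]
      (extChartAt (𝓡 d) x').symm ∘ transition x x' := by
    filter_upwards [(isOpen_transition_domain x x').mem_nhds ⟨hy, hy'⟩] with w hw
    exact ((extChartAt (𝓡 d) x').left_inv hw.2).symm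
  have h2 : mfderiv (𝓡 d) (𝓡 d) (extChartAt (𝓡 d) x).symm y =
      mfderiv (𝓡 d) (𝓡 d) ((extChartAt (𝓡 d) x').symm ∘ transition x x') y := h1.mfderiv_eq
  have h3 := mfderiv_comp (I := 𝓡 d) (I' := 𝓡 d) (I'' := 𝓡 d) y
    (g := (extChartAt (𝓡 d) x').symm) (f := transition x x')
    (mdifferentiableAt_extChartAt_symm_of_mem ((extChartAt (𝓡 d) x').map_source hy'))
    (differentiableAt_transition hy hy').mdifferentiableAt
  rw [mfderiv_eq_fderiv] at h3
  exact h2.trans h3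

/-- By the chain rule the two Gram matrices are congruent through the Jacobian of the transition
map, whose determinant leaves the square root as an absolute value. This is the factor in the change
of variables formula. -/
theorem chartDensity_transition {x x' : M} {y : EuclideanSpace ℝ (Fin d)}
    (hy : y ∈ (extChartAt (𝓡 d) x).target)
    (hy' : (extChartAt (𝓡 d) x).symm y ∈ (extChartAt (𝓡 d) x').source) :
    chartDensity x y =
      |(fderiv ℝ (transition x x') y).det| * chartDensity x' (transition x x' y) := by
  have hp : (extChartAt (𝓡 d) x').symm (transition x x' y) = (extChartAt (𝓡 d) x).symm y :=
    (extChartAt (𝓡 d) x').left_inv hy'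
  rw [chartDensity_eq, chartDensity_eq, hp, dchartSymm_eq_comp hy hy']
  have h1 := det_gram_comp ((metricForm ((extChartAt (𝓡 d) x).symm y)).comp
      (dchartSymm x' (transition x x' y)).toLinearMap
      (dchartSymm x' (transition x x' y)).toLinearMap) (fderiv ℝ (transition x x') y)
  rw [← Real.sqrt_sq_eq_abs, ← Real.sqrt_mul (sq_nonneg _), ← h1]
  rfl

end Density

/-! ### The Riemannian volume in a chart. -/

section Volume

variable {d : ℕ} {M : Type*} [MetricSpace M] [MeasurableSpace M] [BorelSpace M]
  [ChartedSpace (EuclideanSpace ℝ (Fin d)) M]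
  [IsManifold (𝓡 d) ∞ M] [RiemannianBundle (fun x : M => TangentSpace (𝓡 d) x)]

theorem measurableSet_target_inter_preimage (x : M) {s : Set M} (hs : MeasurableSet s) :
    MeasurableSet ((extChartAt (𝓡 d) x).target ∩ (extChartAt (𝓡 d) x).symm ⁻¹' s) := by
  have ht := (isOpen_extChartAt_target (I := 𝓡 d) x).measurableSet
  have h1 : Measurable ((extChartAt (𝓡 d) x).target.domRestrict (extChartAt (𝓡 d) x).symm) :=
    (continuousOn_iff_continuous_domRestrict.1 (continuousOn_extChartAt_symm x)).measurable
  have h2 := ht.subtype_image (h1 hs)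
  convert h2 using 1
  ext y
  constructor
  · rintro ⟨h3, h4⟩
    exact ⟨⟨y, h3⟩, h4, rfl⟩
  · rintro ⟨⟨w, h3⟩, h4, rfl⟩
    exact ⟨h3, h4⟩

theorem chartVolume_apply (x : M) {s : Set M} (hs : MeasurableSet s) :
    chartVolume (d := d) x s =
      ∫⁻ y in (extChartAt (𝓡 d) x).target ∩ (extChartAt (𝓡 d) x).symm ⁻¹' s,
        ENNReal.ofReal (chartDensity x y) := by
  have ht := (isOpen_extChartAt_target (I := 𝓡 d) x).measurableSet
  have hm : AEMeasurable (extChartAt (𝓡 d) x).symm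
      (volume.restrict (extChartAt (𝓡 d) x).target) :=
    (continuousOn_extChartAt_symm x).aemeasurable ht
  have hm' := hm.mono_ac (withDensity_absolutelyContinuous _
    (fun y => ENNReal.ofReal (chartDensity x y)))
  rw [chartVolume, Measure.map_apply_of_aemeasurable hm' hs, ← restrict_withDensity ht,
    Measure.restrict_apply' ht, inter_comm, withDensity_apply _
    (measurableSet_target_inter_preimage x hs)]

theorem chartVolume_inter_source (x : M) {s : Set M} (hs : MeasurableSet s) :
    chartVolume (d := d) x s = chartVolume (d := d) x (s ∩ (extChartAt (𝓡 d) x).source) := by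
  rw [chartVolume_apply x hs, chartVolume_apply x (hs.inter (isOpen_extChartAt_source x).measurableSet)]
  congr 2
  ext y
  simp only [mem_inter_iff, mem_preimage]
  exact ⟨fun h => ⟨h.1, h.2, (extChartAt (𝓡 d) x).map_target h.1⟩, fun h => ⟨h.1, h.2.1⟩⟩

/-- The chart measures agree on the overlaps of the chart domains. -/
theorem chartVolume_eq_of_subset (x x' : M) {s : Set M} (hs : MeasurableSet s)
    (h : s ⊆ (extChartAt (𝓡 d) x).source) (h' : s ⊆ (extChartAt (𝓡 d) x').source) :
    chartVolume (d := d) x' s = chartVolume (d := d) x s := by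
  rw [chartVolume_apply x hs, chartVolume_apply x' hs]
  set t := (extChartAt (𝓡 d) x).target ∩ (extChartAt (𝓡 d) x).symm ⁻¹' s with ht
  have himage : (extChartAt (𝓡 d) x').target ∩ (extChartAt (𝓡 d) x').symm ⁻¹' s =
      transition x x' '' t := by
    ext y
    constructor
    · rintro ⟨hy1, hy2⟩
      refine ⟨extChartAt (𝓡 d) x ((extChartAt (𝓡 d) x').symm y),
        ⟨(extChartAt (𝓡 d) x).map_source (h hy2), ?_⟩, ?_⟩
      · rw [mem_preimage, (extChartAt (𝓡 d) x).left_inv (h hy2)]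
        exact hy2
      · simp only [transition, Function.comp_apply]
        rw [(extChartAt (𝓡 d) x).left_inv (h hy2), (extChartAt (𝓡 d) x').right_inv hy1]
    · rintro ⟨w, ⟨hw1, hw2⟩, rfl⟩
      refine ⟨(extChartAt (𝓡 d) x').map_source (h' hw2), ?_⟩
      simp only [transition, Function.comp_apply, mem_preimage]
      rw [(extChartAt (𝓡 d) x').left_inv (h' hw2)]
      exact hw2
  have hinj : InjOn (transition x x') t := by
    intro y hy w hw hyw
    have h1 := (extChartAt (𝓡 d) x').injOn (h' hy.2) (h' hw.2) hyw
    exact (extChartAt (𝓡 d) x).symm.injOn hy.1 hw.1 h1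
  have htm : MeasurableSet t := measurableSet_target_inter_preimage x hs
  rw [himage, lintegral_image_eq_lintegral_abs_det_fderiv_mul volume htm
    (f' := fderiv ℝ (transition x x'))
    (fun y hy => (differentiableAt_transition hy.1 (h' hy.2)).hasFDerivAt.hasFDerivWithinAt) hinj]
  refine setLIntegral_congr_fun htm fun y hy => ?_
  rw [chartDensity_transition hy.1 (h' hy.2), ENNReal.ofReal_mul (abs_nonneg _)]

/-- The Riemannian volume measure restricts to the chart measure on a chart domain. -/
theorem riemannianVolume_eq_chartVolume (x : M) {s : Set M} (hs : MeasurableSet s)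
    (h : s ⊆ (extChartAt (𝓡 d) x).source) :
    riemannianVolume d M s = chartVolume (d := d) x s := by
  have hU : MeasurableSet (extChartAt (𝓡 d) x).source :=
    (isOpen_extChartAt_source (I := 𝓡 d) x).measurableSet
  refine le_antisymm ?_ (Measure.le_iff'.1 (le_iSup (fun x : M => chartVolume (d := d) x) x) s)
  -- The right side is a measure that dominates every chart measure, hence also their supremum; its
  -- second term vanishes on subsets of the chart domain.
  have hle : riemannianVolume d M ≤ chartVolume (d := d) x +
      (riemannianVolume d M).restrict (extChartAt (𝓡 d) x).sourceᶜ := by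
    refine iSup_le fun x' => Measure.le_iff.2 fun t ht => ?_
    rw [← measure_inter_add_sdiff t hU, Measure.add_apply]
    refine add_le_add ?_ ?_
    · have hm := (ht.inter hU)
      have hU' : MeasurableSet (extChartAt (𝓡 d) x').source :=
        (isOpen_extChartAt_source (I := 𝓡 d) x').measurableSet
      rw [chartVolume_inter_source x' hm, chartVolume_eq_of_subset x x' (hm.inter hU')
        (fun y hy => hy.1.2) (fun y hy => hy.2)]
      exact measure_mono fun y hy => hy.1.1
    · rw [Measure.restrict_apply ht, ← sdiff_eq]
      exact Measure.le_iff'.1 (le_iSup (fun x : M => chartVolume (d := d) x) x') _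
  refine (Measure.le_iff.1 hle s hs).trans ?_
  rw [Measure.add_apply, Measure.restrict_apply hs, ← sdiff_eq, sdiff_eq_empty.2 h, measure_empty,
    add_zero]

end Volume

/-! ### Local control of charts and densities. -/

section LocalBounds

variable {d : ℕ} {M : Type*} [MetricSpace M]
  [ChartedSpace (EuclideanSpace ℝ (Fin d)) M]
  [IsManifold (𝓡 d) ∞ M] [RiemannianBundle (fun x : M => TangentSpace (𝓡 d) x)]
  [IsContMDiffRiemannianBundle (𝓡 d) ∞ (EuclideanSpace ℝ (Fin d))
    (fun x : M => TangentSpace (𝓡 d) x)]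

variable (d M) in
theorem isContinuousRiemannianBundle_tangentSpace :
    IsContinuousRiemannianBundle (EuclideanSpace ℝ (Fin d))
      (fun x : M => TangentSpace (𝓡 d) x) :=
  let ⟨g, hg, h⟩ := IsContMDiffRiemannianBundle.exists_contMDiff (IB := 𝓡 d) (n := ∞)
    (F := EuclideanSpace ℝ (Fin d)) (E := fun x : M => TangentSpace (𝓡 d) x)
  ⟨g, hg.continuous, h⟩

theorem eventually_norm_mfderiv_extChartAt_apply_le (x : M) :
    ∃ C > 0, ∀ᶠ p in 𝓝 x, ∀ v : TangentSpace (𝓡 d) p,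
      norm (E := EuclideanSpace ℝ (Fin d))
        (mfderiv (𝓡 d) 𝓘(ℝ, EuclideanSpace ℝ (Fin d)) (extChartAt (𝓡 d) x) p v) ≤ C * ‖v‖ := by
  have := isContinuousRiemannianBundle_tangentSpace d M
  obtain ⟨C, hC, h⟩ := eventually_norm_mfderiv_extChartAt_lt (𝓡 d) x
  refine ⟨C, hC, h.mono fun p hp v => ?_⟩
  let _ := fun y : EuclideanSpace ℝ (Fin d) => normedAddCommGroupTangentSpaceVectorSpace y
  let _ := fun y : EuclideanSpace ℝ (Fin d) => normedSpaceTangentSpaceVectorSpace y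
  exact (ContinuousLinearMap.le_opNorm _ v).trans
    (mul_le_mul_of_nonneg_right hp.le (norm_nonneg _))

theorem eventually_norm_mfderiv_extChartAt_symm_apply_le (x : M) :
    ∃ C > 0, ∀ᶠ y in 𝓝 (extChartAt (𝓡 d) x x), ∀ u : EuclideanSpace ℝ (Fin d),
      ‖mfderiv (𝓡 d) (𝓡 d) (extChartAt (𝓡 d) x).symm y u‖ ≤ C * ‖u‖ := by
  have := isContinuousRiemannianBundle_tangentSpace d M
  obtain ⟨C, hC, h⟩ := eventually_norm_mfderivWithin_symm_extChartAt_lt (𝓡 d) x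
  simp only [(𝓡 d).range_eq_univ, nhdsWithin_univ, mfderivWithin_univ] at h
  refine ⟨C, hC, h.mono fun p hp v => ?_⟩
  let _ := fun y : EuclideanSpace ℝ (Fin d) => normedAddCommGroupTangentSpaceVectorSpace y
  let _ := fun y : EuclideanSpace ℝ (Fin d) => normedSpaceTangentSpaceVectorSpace y
  exact (ContinuousLinearMap.le_opNorm _ v).trans
    (mul_le_mul_of_nonneg_right hp.le (norm_nonneg _))

/-- The differentials of the chart and of its inverse are mutually inverse, so the two bounds pin
the pulled-back metric between `C₁⁻²‖u‖²` and `C₂²‖u‖²`. -/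
theorem chartDensity_mem_Icc {x : M} {y : EuclideanSpace ℝ (Fin d)}
    (hy : y ∈ (extChartAt (𝓡 d) x).target) {C₁ C₂ : ℝ} (hC₁ : 0 < C₁) (hC₂ : 0 < C₂)
    (h₁ : ∀ v : TangentSpace (𝓡 d) ((extChartAt (𝓡 d) x).symm y),
      norm (E := EuclideanSpace ℝ (Fin d)) (mfderiv (𝓡 d) 𝓘(ℝ, EuclideanSpace ℝ (Fin d))
        (extChartAt (𝓡 d) x) ((extChartAt (𝓡 d) x).symm y) v) ≤ C₁ * ‖v‖)
    (h₂ : ∀ u : EuclideanSpace ℝ (Fin d),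
      ‖mfderiv (𝓡 d) (𝓡 d) (extChartAt (𝓡 d) x).symm y u‖ ≤ C₂ * ‖u‖) :
    C₁⁻¹ ^ d ≤ chartDensity x y ∧ chartDensity x y ≤ C₂ ^ d := by
  have hB : ∀ u, (metricForm ((extChartAt (𝓡 d) x).symm y)).comp
      (dchartSymm x y).toLinearMap (dchartSymm x y).toLinearMap u u =
      ‖mfderiv (𝓡 d) (𝓡 d) (extChartAt (𝓡 d) x).symm y u‖ ^ 2 := fun u =>
    real_inner_self_eq_norm_sq (F := TangentSpace (𝓡 d) ((extChartAt (𝓡 d) x).symm y)) _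
  have hid := mfderiv_extChartAt_comp_mfderivWithin_extChartAt_symm hy
  simp only [(𝓡 d).range_eq_univ, mfderivWithin_univ] at hid
  have hlow : ∀ u : EuclideanSpace ℝ (Fin d),
      ‖u‖ ≤ C₁ * ‖mfderiv (𝓡 d) (𝓡 d) (extChartAt (𝓡 d) x).symm y u‖ := by
    intro u
    have h3 : mfderiv (𝓡 d) 𝓘(ℝ, EuclideanSpace ℝ (Fin d)) (extChartAt (𝓡 d) x)
        ((extChartAt (𝓡 d) x).symm y) (mfderiv (𝓡 d) (𝓡 d) (extChartAt (𝓡 d) x).symm y u) = u :=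
      congr($hid u)
    have h4 := h₁ (mfderiv (𝓡 d) (𝓡 d) (extChartAt (𝓡 d) x).symm y u)
    rw [h3] at h4
    exact h4
  obtain ⟨hl, hu⟩ := det_gram_mem_Icc ((metricForm ((extChartAt (𝓡 d) x).symm y)).comp
      (dchartSymm x y).toLinearMap (dchartSymm x y).toLinearMap)
    (fun u w => real_inner_comm (F := TangentSpace (𝓡 d) ((extChartAt (𝓡 d) x).symm y)) _ _)
    (c := C₁⁻¹ ^ 2) (C := C₂ ^ 2) (by positivity)
    (fun u => by
      rw [hB, ← mul_pow]
      gcongr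
      rw [inv_mul_le_iff₀ hC₁]
      exact hlow u)
    (fun u => by
      rw [hB, ← mul_pow]
      gcongr
      exact h₂ u)
  rw [chartDensity_eq]
  constructor
  · refine Real.le_sqrt_of_sq_le ?_
    rwa [← pow_mul, mul_comm, pow_mul]
  · rw [Real.sqrt_le_left (by positivity)]
    rwa [← pow_mul, mul_comm d, pow_mul]

/-- By convexity the coordinate segment stays in `s`, and the length of its image bounds the
Riemannian distance. -/
theorem dist_extChartAt_symm_le [IsRiemannianManifold (𝓡 d) M] {x : M}
    {s : Set (EuclideanSpace ℝ (Fin d))} (hs : Convex ℝ s) (hst : s ⊆ (extChartAt (𝓡 d) x).target)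
    {C : ℝ} (hC : 0 ≤ C) (h : ∀ y ∈ s, ∀ u : EuclideanSpace ℝ (Fin d),
      ‖mfderiv (𝓡 d) (𝓡 d) (extChartAt (𝓡 d) x).symm y u‖ ≤ C * ‖u‖)
    {u w : EuclideanSpace ℝ (Fin d)} (hu : u ∈ s) (hw : w ∈ s) :
    dist ((extChartAt (𝓡 d) x).symm u) ((extChartAt (𝓡 d) x).symm w) ≤ C * dist u w := by
  let η := ContinuousAffineMap.lineMap (R := ℝ) u w
  have hη : ∀ t ∈ Icc (0 : ℝ) 1, η t ∈ s := by
    intro t ht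
    refine hs.segment_subset hu hw ?_
    rw [segment_eq_image_lineMap]
    exact ⟨t, ht, rfl⟩
  have η_smooth : ContMDiffOn 𝓘(ℝ, ℝ) (𝓡 d) 1 η (Icc 0 1) := by
    apply ContMDiff.contMDiffOn
    rw [contMDiff_iff_contDiff]
    exact ContinuousAffineMap.contDiff _
  have h1 : riemannianEDist (𝓡 d) ((extChartAt (𝓡 d) x).symm u) ((extChartAt (𝓡 d) x).symm w) ≤
      pathELength (𝓡 d) ((extChartAt (𝓡 d) x).symm ∘ η) 0 1 := by
    apply riemannianEDist_le_pathELength _ _ _ zero_le_one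
    · exact (contMDiffOn_extChartAt_symm x).comp η_smooth fun t ht => hst (hη t ht)
    · simp [η, ContinuousAffineMap.coe_lineMap_eq]
    · simp [η, ContinuousAffineMap.coe_lineMap_eq]
  have h2 : pathELength (𝓡 d) ((extChartAt (𝓡 d) x).symm ∘ η) 0 1 ≤
      ENNReal.ofReal C * edist u w := by
    rw [← lintegral_fderiv_lineMap_eq_edist, pathELength_eq_lintegral_mfderivWithin_Icc,
      ← lintegral_const_mul' _ _ ENNReal.ofReal_ne_top]
    refine setLIntegral_mono' measurableSet_Icc fun t ht => ?_
    have h3 : mfderivWithin 𝓘(ℝ, ℝ) (𝓡 d) ((extChartAt (𝓡 d) x).symm ∘ η) (Icc 0 1) t =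
        (mfderiv (𝓡 d) (𝓡 d) (extChartAt (𝓡 d) x).symm (η t)) ∘L
          (mfderivWithin 𝓘(ℝ, ℝ) (𝓡 d) η (Icc 0 1) t) := by
      apply mfderiv_comp_mfderivWithin
      · exact mdifferentiableAt_extChartAt_symm_of_mem (hst (hη t ht))
      · exact η_smooth.mdifferentiableOn one_ne_zero t ht
      · rw [uniqueMDiffWithinAt_iff_uniqueDiffWithinAt]
        exact uniqueDiffOn_Icc zero_lt_one t ht
    rw [h3, mfderivWithin_eq_fderivWithin]
    have h4 := h (η t) (hη t ht) (fderivWithin ℝ η (Icc 0 1) t 1)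
    rw [← ENNReal.ofReal_le_ofReal_iff (by positivity), ENNReal.ofReal_mul hC, ofReal_norm,
      ofReal_norm] at h4
    exact h4
  rw [← IsRiemannianManifold.out] at h1
  have h5 := h1.trans h2
  rw [edist_dist, edist_dist, ← ENNReal.ofReal_mul hC,
    ENNReal.ofReal_le_ofReal_iff (by positivity)] at h5
  exact h5

end LocalBounds

/-! ### Volumes of balls, in the manifold and in `Ω`. -/

section Ahlfors

variable {d : ℕ} {M : Type*} [MetricSpace M] [MeasurableSpace M] [BorelSpace M]
  [ChartedSpace (EuclideanSpace ℝ (Fin d)) M]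
  [IsManifold (𝓡 d) ∞ M] [RiemannianBundle (fun x : M => TangentSpace (𝓡 d) x)]
  [IsContMDiffRiemannianBundle (𝓡 d) ∞ (EuclideanSpace ℝ (Fin d))
    (fun x : M => TangentSpace (𝓡 d) x)]
  [IsRiemannianManifold (𝓡 d) M]

/-- Near `x` the preferred chart is bi-Lipschitz and its volume density is bounded above and
below. -/
theorem exists_chart_bounds (x : M) :
    ∃ C₁ > 0, ∃ C₂ > 0, ∃ ε > 0, ∃ R > 0,
      Metric.ball (extChartAt (𝓡 d) x x) ε ⊆ (extChartAt (𝓡 d) x).target ∧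
      (∀ y ∈ Metric.ball (extChartAt (𝓡 d) x x) ε,
        C₁⁻¹ ^ d ≤ chartDensity x y ∧ chartDensity x y ≤ C₂ ^ d) ∧
      (∀ u ∈ Metric.ball (extChartAt (𝓡 d) x x) ε, ∀ w ∈ Metric.ball (extChartAt (𝓡 d) x x) ε,
        dist ((extChartAt (𝓡 d) x).symm u) ((extChartAt (𝓡 d) x).symm w) ≤ C₂ * dist u w) ∧
      Metric.ball x R ⊆ (extChartAt (𝓡 d) x).source ∧
      (∀ p ∈ Metric.ball x R,
        extChartAt (𝓡 d) x p ∈ Metric.ball (extChartAt (𝓡 d) x x) (ε / 2)) ∧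
      ∀ a b : M, ∀ r : ℝ, dist a b < r → dist a x + r ≤ R →
        dist (extChartAt (𝓡 d) x a) (extChartAt (𝓡 d) x b) ≤ C₁ * r := by
  obtain ⟨C₁, hC₁, h₁⟩ := eventually_norm_mfderiv_extChartAt_apply_le (d := d) x
  obtain ⟨C₂, hC₂, h₂⟩ := eventually_norm_mfderiv_extChartAt_symm_apply_le (d := d) x
  have h₁' : ∀ᶠ y in 𝓝 (extChartAt (𝓡 d) x x),
      ∀ v : TangentSpace (𝓡 d) ((extChartAt (𝓡 d) x).symm y),
      norm (E := EuclideanSpace ℝ (Fin d)) (mfderiv (𝓡 d) 𝓘(ℝ, EuclideanSpace ℝ (Fin d))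
        (extChartAt (𝓡 d) x) ((extChartAt (𝓡 d) x).symm y) v) ≤ C₁ * ‖v‖ := by
    have hc : Tendsto (extChartAt (𝓡 d) x).symm (𝓝 (extChartAt (𝓡 d) x x)) (𝓝 x) := by
      have := continuousAt_extChartAt_symm (I := 𝓡 d) x
      rwa [ContinuousAt, extChartAt_to_inv] at this
    exact hc.eventually h₁
  obtain ⟨ε, hε, hball⟩ := Metric.mem_nhds_iff.1
    (inter_mem (extChartAt_target_mem_nhds (I := 𝓡 d) x) (inter_mem h₁' h₂))
  have hpre : (extChartAt (𝓡 d) x) ⁻¹' Metric.ball (extChartAt (𝓡 d) x x) (ε / 2) ∈ 𝓝 x :=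
    (continuousAt_extChartAt x).preimage_mem_nhds (Metric.ball_mem_nhds _ (by positivity))
  obtain ⟨R, hR, hRball⟩ := Metric.mem_nhds_iff.1
    (inter_mem (extChartAt_source_mem_nhds (I := 𝓡 d) x) (inter_mem h₁ hpre))
  refine ⟨C₁, hC₁, C₂, hC₂, ε, hε, R, hR, fun y hy => (hball hy).1,
    fun y hy => chartDensity_mem_Icc (hball hy).1 hC₁ hC₂ (hball hy).2.1 (hball hy).2.2,
    fun u hu w hw => dist_extChartAt_symm_le (convex_ball _ _) (fun y hy => (hball hy).1) hC₂.le
      (fun y hy => (hball hy).2.2) hu hw,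
    fun p hp => (hRball hp).1, fun p hp => (hRball hp).2.2, fun a b r hab hr => ?_⟩
  rw [dist_eq_norm]
  refine norm_sub_le_of_mfderiv_le (d := d) (G := ⟨C₁, hC₁.le⟩) (z := x) (R := R) ?_ ?_ hab hr
  · refine contMDiffOn_extChartAt.mono fun p hp => ?_
    have := (hRball hp).1
    rwa [extChartAt_source] at this
  · intro y hy v
    have h3 := (hRball hy).2.1 v
    rw [← ENNReal.ofReal_le_ofReal_iff (by positivity), ENNReal.ofReal_mul hC₁.le, ofReal_norm,
      ENNReal.ofReal_eq_coe_nnreal hC₁.le] at h3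
    exact (ofReal_norm (E := EuclideanSpace ℝ (Fin d)) _).symm.trans_le h3

theorem ofReal_mul_volume_ball (c : ℝ) (hc : 0 ≤ c) (y : EuclideanSpace ℝ (Fin d)) {r : ℝ}
    (hr : 0 ≤ r) :
    ENNReal.ofReal c * volume (Metric.closedBall y r) =
      ENNReal.ofReal (c * volume.real (Metric.ball (0 : EuclideanSpace ℝ (Fin d)) 1) * r ^ d) := by
  rw [Measure.addHaar_closedBall _ _ hr, finrank_euclideanSpace_fin,
    ENNReal.ofReal_mul (by positivity), ENNReal.ofReal_mul hc, mul_assoc, Measure.real,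
    ENNReal.ofReal_toReal Metric.isBounded_ball.measure_lt_top.ne, mul_comm (volume _)]

/-- Locally, the volume of a ball of radius `r` is comparable to `r ^ d`. -/
theorem exists_volume_ball_bounds (x : M) :
    ∃ ρ > 0, ∃ c > 0, ∃ C : ℝ, ∀ y ∈ Metric.ball x ρ, ∀ r, 0 < r → r ≤ ρ →
      ENNReal.ofReal (c * r ^ d) ≤ riemannianVolume d M (Metric.ball y r) ∧
        riemannianVolume d M (Metric.ball y r) ≤ ENNReal.ofReal (C * r ^ d) := by
  obtain ⟨C₁, hC₁, C₂, hC₂, ε, hε, R, hR, htgt, hdens, hLip, hsrc, hmem, hLip'⟩ :=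
    exists_chart_bounds (d := d) x
  set V := volume.real (Metric.ball (0 : EuclideanSpace ℝ (Fin d)) 1) with hV
  have hV0 : 0 < V := ENNReal.toReal_pos (Metric.measure_ball_pos volume _ one_pos).ne'
    Metric.isBounded_ball.measure_lt_top.ne
  -- `R/2` keeps `B(y, r)` inside `B(x, R)`; `C₂ε/2` keeps the coordinate ball of radius `r/(2C₂)`
  -- inside the `ε`-ball. That coordinate ball maps into `B(y, r)`, while the coordinate image of
  -- `B(y, r)` has radius at most `C₁r`.
  refine ⟨min (R / 2) (C₂ * ε / 2), by positivity, C₁⁻¹ ^ d * V * (2 * C₂)⁻¹ ^ d, by positivity,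
    C₂ ^ d * V * C₁ ^ d, fun y hy r hr hrρ => ?_⟩
  have hyx : dist y x < R / 2 := hy.trans_le (min_le_left _ _)
  have hrR : r ≤ R / 2 := hrρ.trans (min_le_left _ _)
  have hrε : r ≤ C₂ * ε / 2 := hrρ.trans (min_le_right _ _)
  have hyR : y ∈ Metric.ball x R := by rw [Metric.mem_ball]; linarith
  have hsub : Metric.ball y r ⊆ Metric.ball x R := Metric.ball_subset_ball' (by linarith)
  rw [riemannianVolume_eq_chartVolume x measurableSet_ball (hsub.trans hsrc),
    chartVolume_apply x measurableSet_ball]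
  constructor
  · have hb : Metric.closedBall (extChartAt (𝓡 d) x y) ((2 * C₂)⁻¹ * r) ⊆
        Metric.ball (extChartAt (𝓡 d) x x) ε := by
      refine Metric.closedBall_subset_ball' ?_
      have h1 := hmem y hyR
      rw [Metric.mem_ball] at h1
      have h2 : (2 * C₂)⁻¹ * r ≤ ε / 4 := by
        rw [inv_mul_le_iff₀ (by positivity)]
        linarith
      linarith
    calc ENNReal.ofReal (C₁⁻¹ ^ d * V * (2 * C₂)⁻¹ ^ d * r ^ d)
        = ENNReal.ofReal (C₁⁻¹ ^ d) *
            volume (Metric.closedBall (extChartAt (𝓡 d) x y) ((2 * C₂)⁻¹ * r)) := by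
          rw [ofReal_mul_volume_ball _ (by positivity) _ (by positivity), mul_pow, mul_assoc,
            mul_assoc]
      _ = ∫⁻ _ in Metric.closedBall (extChartAt (𝓡 d) x y) ((2 * C₂)⁻¹ * r),
            ENNReal.ofReal (C₁⁻¹ ^ d) := (setLIntegral_const _ _).symm
      _ ≤ ∫⁻ w in Metric.closedBall (extChartAt (𝓡 d) x y) ((2 * C₂)⁻¹ * r),
            ENNReal.ofReal (chartDensity x w) :=
          setLIntegral_mono' measurableSet_closedBall fun w hw =>
            ENNReal.ofReal_le_ofReal (hdens w (hb hw)).1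
      _ ≤ _ := by
          refine lintegral_mono_set fun w hw => ⟨htgt (hb hw), ?_⟩
          have h1 := hLip w (hb hw) _ (hb (Metric.mem_closedBall_self (by positivity)))
          rw [(extChartAt (𝓡 d) x).left_inv (hsrc hyR)] at h1
          rw [mem_preimage, Metric.mem_ball]
          have h2 : C₂ * dist w (extChartAt (𝓡 d) x y) ≤ C₂ * ((2 * C₂)⁻¹ * r) :=
            mul_le_mul_of_nonneg_left hw hC₂.le
          have h3 : C₂ * ((2 * C₂)⁻¹ * r) = r / 2 := by field_simp
          linarith
  · have hsub' : (extChartAt (𝓡 d) x).target ∩ (extChartAt (𝓡 d) x).symm ⁻¹' Metric.ball y r ⊆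
        Metric.closedBall (extChartAt (𝓡 d) x y) (C₁ * r) ∩
          Metric.ball (extChartAt (𝓡 d) x x) ε := by
      rintro w ⟨hw1, hw2⟩
      rw [← (extChartAt (𝓡 d) x).right_inv hw1]
      constructor
      · rw [Metric.mem_closedBall, dist_comm]
        exact hLip' _ _ r (Metric.mem_ball'.1 hw2) (by linarith)
      · exact Metric.ball_subset_ball (by linarith) (hmem _ (hsub hw2))
    calc _ ≤ ∫⁻ w in Metric.closedBall (extChartAt (𝓡 d) x y) (C₁ * r) ∩
            Metric.ball (extChartAt (𝓡 d) x x) ε, ENNReal.ofReal (chartDensity x w) :=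
          lintegral_mono_set hsub'
      _ ≤ ∫⁻ _ in Metric.closedBall (extChartAt (𝓡 d) x y) (C₁ * r) ∩
            Metric.ball (extChartAt (𝓡 d) x x) ε, ENNReal.ofReal (C₂ ^ d) :=
          setLIntegral_mono' (measurableSet_closedBall.inter measurableSet_ball) fun w hw =>
            ENNReal.ofReal_le_ofReal (hdens w hw.2).2
      _ = ENNReal.ofReal (C₂ ^ d) * volume (Metric.closedBall (extChartAt (𝓡 d) x y) (C₁ * r) ∩
            Metric.ball (extChartAt (𝓡 d) x x) ε) := setLIntegral_const _ _
      _ ≤ ENNReal.ofReal (C₂ ^ d) * volume (Metric.closedBall (extChartAt (𝓡 d) x y) (C₁ * r)) := by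
          gcongr
          exact inter_subset_left
      _ = _ := by
          rw [ofReal_mul_volume_ball _ (by positivity) _ (by positivity), mul_pow, mul_assoc,
            mul_assoc, mul_assoc]

theorem exists_volume_ball_bounds_of_isCompact {Ω : Set M} (hΩ : IsCompact Ω) :
    ∃ ρ > 0, ∃ c > 0, ∃ C : ℝ, ∀ y ∈ Ω, ∀ r, 0 < r → r ≤ ρ →
      ENNReal.ofReal (c * r ^ d) ≤ riemannianVolume d M (Metric.ball y r) ∧
        riemannianVolume d M (Metric.ball y r) ≤ ENNReal.ofReal (C * r ^ d) := by
  refine hΩ.induction_on (p := fun s => ∃ ρ > 0, ∃ c > 0, ∃ C : ℝ, ∀ y ∈ s, ∀ r, 0 < r → r ≤ ρ →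
      ENNReal.ofReal (c * r ^ d) ≤ riemannianVolume d M (Metric.ball y r) ∧
        riemannianVolume d M (Metric.ball y r) ≤ ENNReal.ofReal (C * r ^ d))
    ⟨1, one_pos, 1, one_pos, 1, by simp⟩ ?_ ?_ ?_
  · rintro s t hst ⟨ρ, hρ, c, hc, C, H⟩
    exact ⟨ρ, hρ, c, hc, C, fun y hy => H y (hst hy)⟩
  · rintro s t ⟨ρ, hρ, c, hc, C, H⟩ ⟨ρ', hρ', c', hc', C', H'⟩
    refine ⟨min ρ ρ', lt_min hρ hρ', min c c', lt_min hc hc', max C C', ?_⟩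
    rintro y (hy | hy) r hr hrρ
    · obtain ⟨h1, h2⟩ := H y hy r hr (hrρ.trans (min_le_left _ _))
      refine ⟨(ENNReal.ofReal_le_ofReal ?_).trans h1, h2.trans (ENNReal.ofReal_le_ofReal ?_)⟩
      · gcongr; exact min_le_left _ _
      · gcongr; exact le_max_left _ _
    · obtain ⟨h1, h2⟩ := H' y hy r hr (hrρ.trans (min_le_right _ _))
      refine ⟨(ENNReal.ofReal_le_ofReal ?_).trans h1, h2.trans (ENNReal.ofReal_le_ofReal ?_)⟩
      · gcongr; exact min_le_right _ _
      · gcongr; exact le_max_right _ _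
  · intro x _
    obtain ⟨ρ, hρ, H⟩ := exists_volume_ball_bounds (d := d) x
    exact ⟨_, mem_nhdsWithin_of_mem_nhds (Metric.ball_mem_nhds x hρ), ρ, hρ, H⟩

theorem riemannianVolume_lt_top_of_isCompact {Ω : Set M} (hΩ : IsCompact Ω) :
    riemannianVolume d M Ω < ⊤ := by
  refine hΩ.measure_lt_top_of_nhdsWithin fun x _ => ?_
  obtain ⟨ρ, hρ, c, hc, C, H⟩ := exists_volume_ball_bounds (d := d) x
  exact ⟨Metric.ball x ρ, mem_nhdsWithin_of_mem_nhds (Metric.ball_mem_nhds x hρ),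
    (H x (Metric.mem_ball_self hρ) ρ hρ le_rfl).2.trans_lt ENNReal.ofReal_lt_top⟩

/-- The volume of `B(x, r) ∩ Ω` is at most a multiple of `r ^ d`, for all radii. -/
theorem exists_volume_ball_inter_le {Ω : Set M} (hΩ : IsCompact Ω) :
    ∃ β > 0, ∀ x ∈ Ω, ∀ r : ℝ, 0 < r →
      riemannianVolume d M (Metric.ball x r ∩ Ω) ≤ ENNReal.ofReal (β * r ^ d) := by
  obtain ⟨ρ, hρ, c, hc, C, H⟩ := exists_volume_ball_bounds_of_isCompact (d := d) hΩ
  have hfin := riemannianVolume_lt_top_of_isCompact (d := d) hΩ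
  set m := (riemannianVolume d M).real Ω
  have hm : 0 ≤ m := measureReal_nonneg
  -- Beyond `ρ` the total volume `m` of `Ω` suffices, as `m ≤ (m/ρ^d) r^d`. The 1 only ensures
  -- positivity.
  refine ⟨max 1 (max C (m / ρ ^ d)), by positivity, fun x hx r hr => ?_⟩
  rcases le_total r ρ with h | h
  · refine (measure_mono inter_subset_left).trans ((H x hx r hr h).2.trans ?_)
    refine ENNReal.ofReal_le_ofReal ?_
    gcongr
    exact (le_max_left _ _).trans (le_max_right _ _)
  · refine (measure_mono inter_subset_right).trans ?_
    refine (ENNReal.ofReal_toReal hfin.ne).symm.trans_le ?_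
    refine ENNReal.ofReal_le_ofReal ?_
    calc m = m / ρ ^ d * ρ ^ d := by field_simp
      _ ≤ max 1 (max C (m / ρ ^ d)) * r ^ d := by
        gcongr
        exact (le_max_right _ _).trans (le_max_right _ _)

/-- In a set with the interior cone property, the volume of `B(x, r) ∩ Ω` is at least a multiple
of `r ^ d`. -/
theorem exists_le_volume_ball_inter {Ω : Set M} (hΩ : IsCompact Ω) {rΩ Γ₁ Γ₂ rflat θ : ℝ}
    (hN : IsNormalRadius (d := d) Ω rΩ Γ₁ Γ₂) (hrflat : 0 < rflat) (hθ₀ : 0 < θ)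
    (hθ₁ : θ < Real.pi / 2) (hcone : InteriorCone d Ω rflat θ) :
    ∃ α > 0, ∀ x ∈ Ω, ∀ r : ℝ, 0 < r → r ≤ rΩ → r ≤ rflat →
      ENNReal.ofReal (α * r ^ d) ≤ riemannianVolume d M (Metric.ball x r ∩ Ω) := by
  obtain ⟨ρ, hρ, c, hc, C, H⟩ := exists_volume_ball_bounds_of_isCompact (d := d) hΩ
  have hσ0 : 0 < Real.sin θ := Real.sin_pos_of_pos_of_lt_pi hθ₀ (by linarith [Real.pi_pos])
  have hΓ0 := hN.lower_pos
  have hrΩ := hN.radius_pos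
  set a := Γ₁ * Real.sin θ * (1 / 2 / (1 + Real.sin θ)) with ha
  have ha0 : 0 < a := by positivity
  -- The cone at scale `r/2` contains a ball of radius `a * r`; the minimum with `ρ/rΩ` shrinks it
  -- to a radius at most `ρ`, where the local volume bound holds.
  refine ⟨c * (min a (ρ / rΩ)) ^ d, by positivity, fun x hx r hr hr1 hr2 => ?_⟩
  obtain ⟨y, hy, -, hball⟩ := exists_ball_subset_of_cone hN hθ₀ hθ₁ hcone hx
    (half_pos hr) (by linarith) (by linarith)
  have hrad : Γ₁ * Real.sin θ * (r / 2 / (1 + Real.sin θ)) = a * r := by rw [ha]; ring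
  rw [hrad] at hball
  have hle : min a (ρ / rΩ) * r ≤ ρ := by
    calc min a (ρ / rΩ) * r ≤ ρ / rΩ * rΩ := by
          gcongr
          exact min_le_right _ _
      _ = ρ := by field_simp
  have h1 := (H y hy (min a (ρ / rΩ) * r) (by positivity) hle).1
  rw [mul_pow, ← mul_assoc] at h1
  refine h1.trans (measure_mono ?_)
  refine (Metric.ball_subset_ball (mul_le_mul_of_nonneg_right (min_le_left _ _) hr.le)).trans ?_
  intro w hw
  obtain ⟨hw1, hw2⟩ := hball hw
  refine ⟨?_, hw1⟩
  rw [Metric.mem_closedBall] at hw2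
  rw [Metric.mem_ball]
  linarith

end Ahlfors

/-! ### Counting separated points by volume. -/

section Counting

/-- Volume comparison bounds the number of `q`-separated points in a ball. -/
theorem card_mul_le_of_separated {M ι : Type*} [MetricSpace M] [MeasurableSpace M] [BorelSpace M]
    {μ : Measure M} {Ω : Set M} (hΩ : MeasurableSet Ω) {x : ι → M} {T : Finset ι} {z : M}
    {q δ a b : ℝ} (hb : 0 ≤ b)
    (hsep : ∀ i ∈ T, ∀ j ∈ T, i ≠ j → q ≤ dist (x i) (x j)) (hδ : ∀ i ∈ T, dist (x i) z ≤ δ)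
    (hlow : ∀ i ∈ T, ENNReal.ofReal a ≤ μ (Metric.ball (x i) (q / 2) ∩ Ω))
    (hup : μ (Metric.ball z (δ + q / 2) ∩ Ω) ≤ ENNReal.ofReal b) : T.card * a ≤ b := by
  rw [← ENNReal.ofReal_le_ofReal_iff hb]
  have hdisj : (T : Set ι).PairwiseDisjoint fun i => Metric.ball (x i) (q / 2) ∩ Ω := by
    intro i hi j hj hij
    refine Disjoint.mono inter_subset_left inter_subset_left ?_
    exact Metric.ball_disjoint_ball (by linarith [hsep i hi j hj hij])
  calc ENNReal.ofReal (T.card * a) = ∑ _i ∈ T, ENNReal.ofReal a := by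
        rw [Finset.sum_const, nsmul_eq_mul, ENNReal.ofReal_mul (Nat.cast_nonneg _),
          ENNReal.ofReal_natCast]
    _ ≤ ∑ i ∈ T, μ (Metric.ball (x i) (q / 2) ∩ Ω) := Finset.sum_le_sum hlow
    _ = μ (⋃ i ∈ T, Metric.ball (x i) (q / 2) ∩ Ω) :=
        (measure_biUnion_finset hdisj fun i _ => measurableSet_ball.inter hΩ).symm
    _ ≤ μ (Metric.ball z (δ + q / 2) ∩ Ω) := by
        refine measure_mono (iUnion₂_subset fun i hi => ?_)
        refine inter_subset_inter_left _ (Metric.ball_subset_ball' ?_)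
        linarith [hδ i hi]
    _ ≤ ENNReal.ofReal b := hup

theorem le_div_mul_pow {N α β q δ : ℝ} {d : ℕ} (hα : 0 < α) (hq : 0 < q)
    (h : N * (α * (q / 2) ^ d) ≤ β * (δ + q / 2) ^ d) :
    N ≤ β / α * (1 + 2 * δ / q) ^ d := by
  have h1 : (1 + 2 * δ / q) = (δ + q / 2) / (q / 2) := by field_simp; ring
  rw [h1, div_pow, div_mul_div_comm, le_div_iff₀ (by positivity)]
  exact h

theorem le_two_mul_sqrt_mul_rpow {s N c₁ α β Y : ℝ} {d : ℕ} (hc₁ : 0 < c₁) (hα : 0 < α)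
    (hβ : 0 ≤ β) (hY : 0 ≤ Y) (hs : s ^ 2 ≤ 4 / c₁ * N) (hN : N ≤ β / α * Y ^ d) :
    s ≤ 2 * Real.sqrt (β / (c₁ * α)) * Y ^ ((d : ℝ) / 2) := by
  refine le_of_sq_le_sq ?_ (by positivity)
  have h1 : (Y ^ ((d : ℝ) / 2)) ^ 2 = Y ^ d := by
    rw [← Real.rpow_natCast (Y ^ ((d : ℝ) / 2)), ← Real.rpow_mul hY, ← Real.rpow_natCast Y]
    congr 1
    push_cast
    ring
  rw [mul_pow, mul_pow, h1, Real.sq_sqrt (by positivity)]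
  calc s ^ 2 ≤ 4 / c₁ * N := hs
    _ ≤ 4 / c₁ * (β / α * Y ^ d) := by gcongr
    _ = 2 ^ 2 * (β / (c₁ * α)) * Y ^ d := by field_simp; ring

end Counting

/-! ### Fill distance and separation. -/

section Points

variable {d : ℕ} {M : Type*} [MetricSpace M] [ChartedSpace (EuclideanSpace ℝ (Fin d)) M]
  [IsManifold (𝓡 d) ∞ M] [RiemannianBundle (fun x : M => TangentSpace (𝓡 d) x)]
  {Ω : Set M} {rΩ Γ₁ Γ₂ rflat θ : ℝ} {Ξ : Finset M}

theorem exists_dist_le_fillDistance (hΩ : IsCompact Ω) (hΞ : Ξ.Nonempty) {x : M} (hx : x ∈ Ω) :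
    ∃ ξ ∈ Ξ, dist x ξ ≤ fillDistance Ξ Ω := by
  obtain ⟨ξ, hξ, h⟩ := Ξ.finite_toSet.isCompact.exists_infDist_eq_dist hΞ x
  refine ⟨ξ, hξ, h ▸ le_csSup ?_ (mem_image_of_mem _ hx)⟩
  exact (hΩ.image (Metric.continuous_infDist_pt _)).bddAbove

/-- The separation is positive and at most twice the fill distance. -/
theorem separation_pos_and_le (hΩ : IsCompact Ω) (hN : IsNormalRadius (d := d) Ω rΩ Γ₁ Γ₂)
    (hcone : InteriorCone d Ω rflat θ) (hΞ : Ξ.Nonempty) (hΞΩ : (Ξ : Set M) ⊆ Ω)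
    (h1 : fillDistance Ξ Ω < rΩ) (h2 : fillDistance Ξ Ω < rflat) :
    0 < separation Ξ ∧ separation Ξ ≤ 2 * fillDistance Ξ Ω := by
  obtain ⟨ξ₀, hξ₀⟩ := hΞ
  have h0 : 0 ≤ fillDistance Ξ Ω := by
    obtain ⟨ξ, -, h⟩ := exists_dist_le_fillDistance hΩ ⟨ξ₀, hξ₀⟩ (hΞΩ hξ₀)
    exact dist_nonneg.trans h
  -- The cone supplies a point of `Ω` at distance `t` from `ξ₀`. Since `t` exceeds the fill
  -- distance, its nearest sample point differs from `ξ₀`; in particular `Ξ` has two points and the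
  -- separation is not the default 0.
  have key : ∀ t, fillDistance Ξ Ω < t → t < rΩ → t ≤ rflat →
      ∃ ξ ∈ Ξ, ξ₀ ≠ ξ ∧ dist ξ₀ ξ ≤ t + fillDistance Ξ Ω := by
    intro t ht ht1 ht2
    obtain ⟨x, hx, hxt⟩ := exists_dist_eq_of_cone hN hcone (hΞΩ hξ₀) (h0.trans ht.le) ht1 ht2
    obtain ⟨ξ, hξ, hxξ⟩ := exists_dist_le_fillDistance hΩ ⟨ξ₀, hξ₀⟩ hx
    refine ⟨ξ, hξ, ?_, ?_⟩
    · rintro rfl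
      rw [dist_comm, hxt] at hxξ
      linarith
    · have := dist_triangle ξ₀ x ξ
      linarith
  constructor
  · obtain ⟨t, ht, ht'⟩ := exists_between (lt_min h1 h2)
    obtain ⟨ξ, hξ, hne, -⟩ := key t ht (ht'.trans_le (min_le_left _ _))
      (ht'.trans_le (min_le_right _ _)).le
    exact (Ξ.finite_toSet.infsep_pos_iff_nontrivial).2 ⟨ξ₀, hξ₀, ξ, hξ, hne⟩
  · by_contra! hlt
    -- If `q > 2h`, a `t` in `(h, q - h)` gives a second sample point at distance at most `t + h <
    -- q`.
    obtain ⟨t, ht, ht'⟩ := exists_between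
      (lt_min (lt_min h1 h2) (show fillDistance Ξ Ω < separation Ξ - fillDistance Ξ Ω by linarith))
    have ht1 := ht'.trans_le (min_le_left _ _)
    have ht2 := ht'.trans_le (min_le_right _ _)
    obtain ⟨ξ, hξ, hne, hd⟩ := key t ht (ht1.trans_le (min_le_left _ _))
      (ht1.trans_le (min_le_right _ _)).le
    have : separation Ξ ≤ dist ξ₀ ξ := Set.infsep_le_dist_of_mem hξ₀ hξ hne
    linarith

end Points

/-! ### A competitor of small cost, and reproduction. -/

section Shape

variable {M : Type*} [MetricSpace M] {P : Submodule ℝ (M → ℝ)} {Ξ : Finset M} {W : M → M → ℝ}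
  {z : M}

open Classical in
/-- A local norming set on which the weight is bounded below yields a feasible vector of small
cost. -/
theorem exists_bgFeasible_of_norming {C R c₁ : ℝ} (hC : 0 ≤ C) (hc₁ : 0 < c₁)
    (hW : ∀ ξ : Ξ, dist (ξ : M) z ≤ R → c₁ ≤ W ξ z)
    (h : ∀ p ∈ P, ∀ m : ℝ, (∀ ξ ∈ Ξ, dist ξ z ≤ R → |p ξ| ≤ m) → |p z| ≤ C * m) :
    ∃ a : Ξ → ℝ, BGFeasible P Ξ W z a ∧ bgCost Ξ W z a ≤ C ^ 2 / c₁ := by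
  obtain ⟨a, ha, haC⟩ := exists_coeff_of_norming P
    (fun i : {ξ : Ξ // dist (ξ : M) z ≤ R} => ((i : Ξ) : M)) z hC
    (fun p hp m _ hm => h p hp m fun ξ hξ hR => hm ⟨⟨ξ, hξ⟩, hR⟩)
  have hinj : Function.Injective (Subtype.val : {ξ : Ξ // dist (ξ : M) z ≤ R} → Ξ) :=
    Subtype.val_injective
  set a' : Ξ → ℝ := Function.extend Subtype.val a 0 with ha'
  have h0 : ∀ ξ : Ξ, ξ ∉ range (Subtype.val : {ξ : Ξ // dist (ξ : M) z ≤ R} → Ξ) → a' ξ = 0 :=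
    fun ξ hξ => Function.extend_apply' _ _ _ hξ
  have h1 : ∀ i, a' (Subtype.val i) = a i := fun i => hinj.extend_apply a 0 i
  have hne : ∀ ξ : Ξ, a' ξ ≠ 0 → c₁ ≤ W ξ z := by
    intro ξ hξ
    by_contra hlt
    refine hξ (h0 ξ ?_)
    rintro ⟨i, rfl⟩
    exact hlt (hW _ i.2)
  refine ⟨a', fun p hp => ?_, bgCost_le_of_le hc₁ hne (le_of_eq_of_le ?_ haC)⟩
  · rw [Finset.sum_filter_of_ne, ← ha p hp]
    · refine (Fintype.sum_of_injective Subtype.val hinj _ _ (fun ξ hξ => ?_) fun i => ?_).symm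
      · rw [h0 ξ hξ, zero_mul]
      · rw [h1]
    · intro ξ _ hξ
      exact hc₁.trans_le (hne ξ (left_ne_zero_of_mul hξ))
  · refine (Fintype.sum_of_injective Subtype.val hinj _ _ (fun ξ hξ => ?_) fun i => ?_).symm
    · rw [h0 ξ hξ, abs_zero]
    · rw [h1]

theorem IsShapeVector.eq_sum (hW0 : ∀ ξ : Ξ, 0 ≤ W ξ z) {b : Ξ → ℝ}
    (hb : IsShapeVector P Ξ W z b) {p : M → ℝ} (hp : p ∈ P) : p z = ∑ ξ : Ξ, b ξ * p ξ := by
  classical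
  rw [← hb.feasible p hp, Finset.sum_filter_of_ne]
  intro ξ _ hξ
  refine (hW0 ξ).lt_of_ne fun h => hξ ?_
  rw [hb.eq_zero ξ h.symm, zero_mul]

end Shape

/-! ### Assembling the constants. -/

section Final

variable {d : ℕ} {M : Type*} [MetricSpace M] [MeasurableSpace M] [BorelSpace M]
  [ChartedSpace (EuclideanSpace ℝ (Fin d)) M]
  [IsManifold (𝓡 d) ∞ M] [RiemannianBundle (fun x : M => TangentSpace (𝓡 d) x)]
  [IsContMDiffRiemannianBundle (𝓡 d) ∞ (EuclideanSpace ℝ (Fin d))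
    (fun x : M => TangentSpace (𝓡 d) x)]
  [IsRiemannianManifold (𝓡 d) M]
  {Ω : Set M} {rΩ Γ₁ Γ₂ rflat rsharp rstar θ : ℝ}

/-- The upper constant is enlarged to `3^d β` to absorb `1 + 2δ/q ≤ 3δ/q` later. The bound with `β`
holds for all radii because `δ + q/2` may exceed `rstar`. -/
theorem exists_ballBound (hΩ : IsCompact Ω) (hN : IsNormalRadius (d := d) Ω rΩ Γ₁ Γ₂)
    (hrflat : 0 < rflat) (hθ₀ : 0 < θ) (hθ₁ : θ < Real.pi / 2) (hcone : InteriorCone d Ω rflat θ)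
    (h1 : rstar ≤ rΩ) (h2 : rstar ≤ rflat) :
    ∃ α w β : ℝ, 0 < α ∧ α ≤ w ∧ BallBound d Ω rstar α w ∧ 0 < β ∧ 3 ^ d * β ≤ w ∧
      (∀ x ∈ Ω, ∀ r : ℝ, 0 < r →
        riemannianVolume d M (Metric.ball x r ∩ Ω) ≤ ENNReal.ofReal (β * r ^ d)) := by
  obtain ⟨β, hβ, hup⟩ := exists_volume_ball_inter_le (d := d) hΩ
  obtain ⟨α, hα, hlow⟩ := exists_le_volume_ball_inter hΩ hN hrflat hθ₀ hθ₁ hcone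
  refine ⟨α, max α (3 ^ d * β), β, hα, le_max_left _ _, fun x hx r hr hr' =>
    ⟨hlow x hx r hr (hr'.trans h1) (hr'.trans h2), (hup x hx r hr).trans
      (ENNReal.ofReal_le_ofReal ?_)⟩, hβ, le_max_right _ _, hup⟩
  gcongr
  refine le_trans ?_ (le_max_right _ _)
  exact le_mul_of_one_le_left hβ.le (one_le_pow₀ (by norm_num))

theorem BallBound.upper_pos {α β : ℝ} (h : BallBound d Ω rstar α β) (hα : 0 < α)
    (hrstar : 0 < rstar) {z : M} (hz : z ∈ Ω) : 0 < β := by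
  obtain ⟨h1, h2⟩ := h z hz rstar hrstar le_rfl
  have h3 : 0 < ENNReal.ofReal (β * rstar ^ d) :=
    lt_of_lt_of_le (ENNReal.ofReal_pos.2 (by positivity)) (h1.trans h2)
  exact pos_of_mul_pos_left (ENNReal.ofReal_pos.1 h3) (by positivity)

end Final

end MLS

end

theorem lemma5p1 {d : ℕ} {M : Type*} [MetricSpace M] [ConnectedSpace M]
    [MeasurableSpace M] [BorelSpace M]
    [ChartedSpace (EuclideanSpace ℝ (Fin d)) M] [IsManifold (𝓡 d) ∞ M]
    [RiemannianBundle (fun x : M => TangentSpace (𝓡 d) x)]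
    [IsContMDiffRiemannianBundle (𝓡 d) ∞ (EuclideanSpace ℝ (Fin d))
      (fun x : M => TangentSpace (𝓡 d) x)]
    [IsRiemannianManifold (𝓡 d) M]
    (Ω : Set M) (hΩ : IsCompact Ω)
    (rΩ Γ₁ Γ₂ : ℝ) (hrΩ : MLS.IsNormalRadius (d := d) Ω rΩ Γ₁ Γ₂)
    (rflat θ : ℝ) (hrflat : 0 < rflat) (hθ₀ : 0 < θ) (hθ₁ : θ < Real.pi / 2)
    (hcone : MLS.InteriorCone d Ω rflat θ)
    (rsharp : ℝ) (hrsharp : 0 < rsharp)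
    (rstar : ℝ) (hrstar : rstar = min rΩ (min rsharp rflat)) :
    ∃ αΩ wΩ : ℝ, 0 < αΩ ∧ αΩ ≤ wΩ ∧ MLS.BallBound d Ω rstar αΩ wΩ ∧
      ∀ (P : Submodule ℝ (M → ℝ)) (D K κ : ℝ), MLS.DoublingMarkov d P D K rsharp →
        κ = MLS.kappa D K Γ₁ θ →
        (1 + Γ₁ * Real.sin θ) / (Γ₁ * Real.sin θ) ≤ κ →
      ∀ (Ξ : Finset M) (h q : ℝ), Ξ.Nonempty → (Ξ : Set M) ⊆ Ω →
        h = MLS.fillDistance Ξ Ω → q = MLS.separation Ξ → h ≤ rstar / (3 * κ) →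
      ∀ (W : M → M → ℝ) (c₀ c₁ δ : ℝ), 0 < c₀ → c₀ < 1 → 0 < c₁ → c₁ ≤ 1 →
        (∀ ζ ∈ Ω, ∀ z ∈ Ω, 0 ≤ W ζ z ∧ W ζ z ≤ 1) →
        (∀ ζ ∈ Ω, ∀ z ∈ Ω, δ ≤ dist ζ z → W ζ z = 0) →
        (∀ ζ ∈ Ω, ∀ z ∈ Ω, dist ζ z ≤ c₀ * δ → c₁ ≤ W ζ z) →
        3 * κ / c₀ * h ≤ δ →
      ∀ z ∈ Ω, ∃ b : Ξ → ℝ,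
        MLS.IsShapeVector P Ξ W z b ∧ (∀ b', MLS.IsShapeVector P Ξ W z b' → b' = b) ∧
        (∀ p ∈ P, p z = ∑ ξ : Ξ, b ξ * p ξ) ∧
        (∀ ξ : Ξ, b ξ ≠ 0 → (ξ : M) ∈ Metric.ball z δ ∩ Ω) ∧
        ∑ ξ : Ξ, |b ξ| ≤ 2 * Real.sqrt (wΩ / (c₁ * αΩ)) * (δ / q) ^ ((d : ℝ) / 2) ∧
        (∀ α β : ℝ, 0 < α → MLS.BallBound d Ω rstar α β → δ + q / 2 ≤ rstar →
          ∑ ξ : Ξ, |b ξ| ≤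
            2 * Real.sqrt (β / (c₁ * α)) * (1 + 2 * δ / q) ^ ((d : ℝ) / 2)) := by
  have hR1 : rstar ≤ rΩ := hrstar ▸ min_le_left _ _
  have hR2 : rstar ≤ rsharp := hrstar ▸ (min_le_right _ _).trans (min_le_left _ _)
  have hR3 : rstar ≤ rflat := hrstar ▸ (min_le_right _ _).trans (min_le_right _ _)
  have hR0 : 0 < rstar := hrstar ▸ lt_min hrΩ.radius_pos (lt_min hrsharp hrflat)
  obtain ⟨αΩ, wΩ, β₀, hα, hαw, hbb, hβ₀, hβw, hup⟩ :=
    MLS.exists_ballBound hΩ hrΩ hrflat hθ₀ hθ₁ hcone hR1 hR3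
  refine ⟨αΩ, wΩ, hα, hαw, hbb, ?_⟩
  rintro P D K κ hP rfl hκ Ξ h q hΞ hΞΩ hh hq hhr W c₀ c₁ δ hc₀ hc₀' hc₁ hc₁' hW01 hWδ hWc hδ z hz
  have hΓ0 := hrΩ.lower_pos
  have hΓ1 := hrΩ.lower_le_one_of_cone hcone hz
  have hσ0 : 0 < Real.sin θ := Real.sin_pos_of_pos_of_lt_pi hθ₀ (by linarith [Real.pi_pos])
  have hκ2 : 2 ≤ MLS.kappa D K Γ₁ θ := MLS.two_le_of_le_kappa (by positivity)
    (mul_le_one₀ hΓ1 hσ0.le (Real.sin_le_one θ)) hκ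
  set κ := MLS.kappa D K Γ₁ θ
  have hκh : 3 * κ * h ≤ rstar := by
    rwa [le_div_iff₀ (by positivity), mul_comm] at hhr
  have hfill : ∀ x ∈ Ω, ∃ ξ ∈ (Ξ : Set M), dist x ξ ≤ h := fun x hx =>
    hh ▸ MLS.exists_dist_le_fillDistance hΩ hΞ hx
  have hh0 : 0 ≤ h := by
    obtain ⟨ξ, -, hξ⟩ := hfill z hz
    exact dist_nonneg.trans hξ
  have h6 : 6 * h ≤ 3 * κ * h := by nlinarith
  have hhr' : h < rstar := by linarith
  obtain ⟨hq0, hqh⟩ : 0 < q ∧ q ≤ 2 * h := by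
    rw [hq, hh]
    exact MLS.separation_pos_and_le hΩ hrΩ hcone hΞ hΞΩ (hh ▸ hhr'.trans_le hR1)
      (hh ▸ hhr'.trans_le hR3)
  have hhpos : 0 < h := by linarith
  have hRδ : 3 * κ * h ≤ c₀ * δ := by
    rw [div_mul_eq_mul_div, div_le_iff₀ hc₀] at hδ
    linarith
  have hδ0 : 0 < δ := pos_of_mul_pos_right (by linarith : 0 < c₀ * δ) hc₀.le
  -- The chain is `q ≤ 2h ≤ 3κh ≤ c₀δ ≤ δ`.
  have hqδ : q ≤ δ := by nlinarith
  have hW0 : ∀ ξ : Ξ, 0 ≤ W ξ z := fun ξ => (hW01 ξ (hΞΩ ξ.2) z hz).1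
  have hW1 : ∀ ξ : Ξ, W ξ z ≤ 1 := fun ξ => (hW01 ξ (hΞΩ ξ.2) z hz).2
  have hWdist : ∀ ξ : Ξ, W ξ z ≠ 0 → dist (ξ : M) z < δ := fun ξ hξ => by
    by_contra! hle
    exact hξ (hWδ ξ (hΞΩ ξ.2) z hz hle)
  obtain ⟨a, ha, hacost⟩ := MLS.exists_bgFeasible_of_norming (P := P) (Ξ := Ξ) (W := W) (z := z)
    (C := 2) (R := 3 * κ * h) zero_le_two hc₁
    (fun ξ hξ => hWc ξ (hΞΩ ξ.2) z hz (hξ.trans hRδ))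
    (fun p hp m hm => MLS.abs_le_two_mul_of_fill hΩ hrΩ hθ₀ hθ₁ hcone hP hκ hhpos hfill
      (hκh.trans hR1) (hκh.trans hR3) (hκh.trans hR2) hz hp hm)
  obtain ⟨b, hb⟩ := MLS.exists_isShapeVector hW0 hW1 ha
  classical
  set T : Finset Ξ := Finset.univ.filter fun ξ : Ξ => 0 < W ξ z with hT
  have hsq : (∑ ξ : Ξ, |b ξ|) ^ 2 ≤ 4 / c₁ * T.card := by
    refine (MLS.sum_abs_sq_le_bgCost_mul_card hW0 hW1 hb.eq_zero).trans ?_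
    have := (hb.minimal a ha).trans hacost
    norm_num at this
    convert mul_le_mul_of_nonneg_right this (Nat.cast_nonneg T.card)
  have hcard : ∀ α β : ℝ, 0 < α → 0 < β →
      (∀ x ∈ Ω, ENNReal.ofReal (α * (q / 2) ^ d) ≤
        MLS.riemannianVolume d M (Metric.ball x (q / 2) ∩ Ω)) →
      MLS.riemannianVolume d M (Metric.ball z (δ + q / 2) ∩ Ω) ≤
        ENNReal.ofReal (β * (δ + q / 2) ^ d) →
      (T.card : ℝ) ≤ β / α * (1 + 2 * δ / q) ^ d := by
    intro α β hα hβ hlow hupp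
    refine MLS.le_div_mul_pow hα hq0 ?_
    refine MLS.card_mul_le_of_separated hΩ.isClosed.measurableSet
      (x := fun ξ : Ξ => (ξ : M)) (z := z) (q := q) (δ := δ) (by positivity) ?_ ?_
      (fun ξ _ => hlow ξ (hΞΩ ξ.2)) hupp
    · intro ξ _ η _ hne
      rw [hq]
      exact Set.infsep_le_dist_of_mem ξ.2 η.2 fun he => hne (Subtype.ext he)
    · intro ξ hξ
      exact (hWdist ξ (Finset.mem_filter.1 hξ).2.ne').le
  have hlow : ∀ α β : ℝ, MLS.BallBound d Ω rstar α β → ∀ x ∈ Ω,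
      ENNReal.ofReal (α * (q / 2) ^ d) ≤
        MLS.riemannianVolume d M (Metric.ball x (q / 2) ∩ Ω) :=
    fun α β hαβ x hx => (hαβ x hx (q / 2) (by positivity) (by linarith)).1
  refine ⟨b, hb, fun b' hb' => hb.unique hW0 hb', fun p hp => hb.eq_sum hW0 hp, fun ξ hξ =>
    ⟨hWdist ξ fun h0 => hξ (hb.eq_zero ξ h0), hΞΩ ξ.2⟩, ?_, fun α β hα' hαβ hδr => ?_⟩
  -- The count uses `β₀`, valid at radius `δ + q/2` whatever its size; the lower bound is needed
  -- only at radius `q/2 ≤ h < rstar`.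
  · have h1 := hcard αΩ β₀ hα hβ₀ (hlow αΩ wΩ hbb) (hup z hz _ (by positivity))
    refine MLS.le_two_mul_sqrt_mul_rpow hc₁ hα (hα.le.trans hαw) (by positivity) hsq
      (h1.trans ?_)
    have h2 : 1 + 2 * δ / q ≤ 3 * (δ / q) := by
      have := (one_le_div hq0).2 hqδ
      linarith [mul_div_assoc 2 δ q]
    calc β₀ / αΩ * (1 + 2 * δ / q) ^ d ≤ β₀ / αΩ * (3 * (δ / q)) ^ d := by gcongr
      _ = 3 ^ d * β₀ / αΩ * (δ / q) ^ d := by rw [mul_pow]; ring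
      _ ≤ wΩ / αΩ * (δ / q) ^ d := by gcongr
  · have hβ' := hαβ.upper_pos hα' hR0 hz
    exact MLS.le_two_mul_sqrt_mul_rpow hc₁ hα' hβ'.le (by positivity) hsq
      (hcard α β hα' hβ' (hlow α β hαβ) (hαβ z hz _ (by positivity) hδr).2)
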